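/- **Notation.** For a set $S$ of primes let $\mathbb{Z}_S\subset\mathbb{Q}$ be the ring of rational numbers whose denominator is divisible by no prime in $S$. Let $A$ be a finite-dimensional semisimple $\mathbb{Q}$-algebra with irreducible central idempotents $e_1,\dots,e_m$, let $\mathfrak{O}$ be a maximal $\mathbb{Z}_S$-order in $A$ (so $e_i\in\mathfrak{O}$ for all $i$), and let $\underline{u}=(u_1,\dots,u_m)\in\mathbb{Q}^m$. For a finite $\mathfrak{O}$-module $G$ put $|G|^{\underline{u}}:=\prod_{i=1}^m|e_iG|^{u_i}$. For a ring $R$ let $\mathrm{Sur}_R(G,H)$ denote the set of surjective $R$-module homomorphisms $G\to H$. Random modules are defined on discrete probability spaces. **Theorem.** (1) Let $S$, $A$, $\mathfrak{O}$, $\underline{u}$ be as above and let $X=X(A,\underline{u},\mathfrak{O})$ be a random finite $\mathfrak{O}$-module with the Cohen–Lenstra–Martinet distribution, i.e. for all finite $\mathfrak{O}$-modules $G_1,G_2$ $$\frac{\mathbb{P}(X\cong G_1)}{\mathbb{P}(X\cong G_2)}=\frac{|G_2|^{\underline{u}}\,|\mathrm{Aut}_{\mathfrak{O}}(G_2)|}{|G_1|^{\underline{u}}\,|\mathrm{Aut}_{\mathfrak{O}}(G_1)|}.$$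 Then for every finite $\mathfrak{O}$-module $H$ $$\mathbb{E}\big(|\mathrm{Sur}_{\mathfrak{O}}(X,H)|\big)=\frac{1}{|H|^{\underline{u}}},$$ and for every central idempotent $e\in\mathfrak{O}$ $$\mathbb{E}\big(|\mathrm{Sur}_{\mathfrak{O}}(eX,H)|\big)=\begin{cases}|H|^{-\underline{u}}&\text{if }eH=H,\\0&\text{otherwise.}\end{cases}$$ (2) Let $\Gamma$ be a finite group, $\Gamma_\infty\le\Gamma$ a subgroup and $R=\mathbb{Z}[|\Gamma|^{-1}][\Gamma]$. Let $X$ be a random finite $R$-module with $X^\Gamma=0$ that has the Cohen–Lenstra–Martinet distribution for $\Gamma$-fields with decomposition group $\Gamma_\infty$ at infinity, i.e. there is a constant $c$ such that $$\mathbb{P}(X\cong H)=\frac{c}{|H^{\Gamma_\infty}|\,|\mathrm{Aut}_R(H)|}$$ for all finite $R$-modules $H$ with $H^\Gamma=0$. Then $\mathbb{E}\big(|\mathrm{Sur}_R(X,H)|\big)=|H^{\Gamma_\infty}|^{-1}$ for every finite $R$-module $H$ with $H^\Gamma=0$. -/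

import Mathlib

open scoped ENNReal

noncomputable section

namespace CLM

/-! ### Maximal orders in semisimple `ℚ`-algebras -/

/-- The ring `ℤ_S`: the rational numbers whose denominator is not divisible by any prime in `S`. -/
def ZS (S : Set Nat.Primes) : Subring ℚ where
  carrier := {q | ∀ p ∈ S, ¬ (p : ℕ) ∣ q.den}
  mul_mem' := by
    intro a b ha hb p hp h
    rcases (p.2.dvd_mul).1 (h.trans (Rat.mul_den_dvd a b)) with h | h
    · exact ha p hp h
    · exact hb p hp h
  one_mem' := by
    intro p _ h
    exact p.2.one_lt.ne' (Nat.dvd_one.1 (by simpa using h))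
  add_mem' := by
    intro a b ha hb p hp h
    rcases (p.2.dvd_mul).1 (h.trans (Rat.add_den_dvd a b)) with h | h
    · exact ha p hp h
    · exact hb p hp h
  zero_mem' := by
    intro p _ h
    exact p.2.one_lt.ne' (Nat.dvd_one.1 (by simpa using h))
  neg_mem' := by
    intro a ha p hp h
    exact ha p hp (by simpa using h)

variable {A : Type*} [Ring A] [Algebra ℚ A] {S : Set Nat.Primes}

/-- A `ℤ_S`-order in `A`: a `ℤ_S`-subalgebra (with the same `1`) that is finitely generated as a
`ℤ_S`-module and spans `A` over `ℚ`. -/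
def IsOrder (O : Subalgebra (ZS S) A) : Prop :=
  (Subalgebra.toSubmodule O).FG ∧ Submodule.span ℚ (O : Set A) = ⊤

/-- A maximal `ℤ_S`-order in `A`: maximal for inclusion among all `ℤ_S`-orders in `A`. -/
def IsMaximalOrder (O : Subalgebra (ZS S) A) : Prop :=
  Maximal IsOrder O

/-- Irreducible (i.e. primitive) central idempotents. In a semisimple algebra `A`
they are exactly the units `e_i` of the simple factors `A_i = e_i A`. -/
structure IsIrreducibleCentralIdempotent (e : A) : Prop where
  ne_zero : e ≠ 0
  idem : e * e = e
  central : ∀ a : A, e * a = a * e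
  irreducible : ∀ f : A, f * f = f → (∀ a : A, f * a = a * f) → f * e = f → f = 0 ∨ f = e

variable (A) in
/-- The index set `{e_1, …, e_m}` of the simple factors of `A`. -/
def IrrIdem : Type _ := {e : A // IsIrreducibleCentralIdempotent e}

/-- A semisimple algebra has finitely many simple factors, so that the products over `IrrIdem A`
below are honest finite products. -/
theorem finite_irrIdem [Module.Finite ℚ A] : Finite (IrrIdem A) := by
  have horth : ∀ i j : IrrIdem A, i ≠ j → i.1 * j.1 = 0 := by
    intro i j hij
    have hc : ∀ a : A, (i.1 * j.1) * a = a * (i.1 * j.1) := fun a => by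
      rw [mul_assoc, j.2.central a, ← mul_assoc, i.2.central a, mul_assoc]
    have hi : (i.1 * j.1) * (i.1 * j.1) = i.1 * j.1 := by
      rw [mul_assoc, ← mul_assoc j.1, ← i.2.central j.1, mul_assoc i.1 j.1 j.1, j.2.idem,
        ← mul_assoc, i.2.idem]
    have h1 := j.2.irreducible _ hi hc (by rw [mul_assoc, j.2.idem])
    have h2 := i.2.irreducible _ hi hc (by
      rw [mul_assoc, ← i.2.central j.1, ← mul_assoc, i.2.idem])
    rcases h1 with h1 | h1
    · exact h1
    · rcases h2 with h2 | h2
      · exact h2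
      · exact absurd (Subtype.ext (h2.symm.trans h1)) hij
  have hli : LinearIndependent ℚ (fun i : IrrIdem A => i.1) := by
    rw [linearIndependent_iff']
    intro s g hg i hi
    have h := congrArg (fun x => i.1 * x) hg
    simp only [Finset.mul_sum, mul_zero, mul_smul_comm] at h
    rw [Finset.sum_eq_single i] at h
    · rw [i.2.idem] at h
      exact (smul_eq_zero.1 h).resolve_right i.2.ne_zero
    · intro j _ hj
      rw [horth i j hj.symm, smul_zero]
    · intro h
      exact absurd hi h
  exact hli.finite

/-- A maximal order contains all central idempotents of the algebra. -/
theorem IsMaximalOrder.mem {O : Subalgebra (ZS S) A} (hO : IsMaximalOrder O) {e : A}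
    (he : e * e = e) (hc : ∀ a : A, e * a = a * e) : e ∈ O := by
  let O' : Subalgebra (ZS S) A :=
    { carrier := {x | ∃ a ∈ O, ∃ b ∈ O, x = a + e * b}
      mul_mem' := by
        rintro _ _ ⟨a, ha, b, hb, rfl⟩ ⟨c, hc', d, hd, rfl⟩
        refine ⟨a * c, O.mul_mem ha hc', a * d + b * c + b * d,
          O.add_mem (O.add_mem (O.mul_mem ha hd) (O.mul_mem hb hc')) (O.mul_mem hb hd), ?_⟩
        have h1 : a * (e * d) = e * (a * d) := by rw [← mul_assoc, ← hc a, mul_assoc]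
        have h2 : e * b * (e * d) = e * (b * d) := by
          rw [mul_assoc, ← mul_assoc b, ← hc b, mul_assoc e b d, ← mul_assoc e e, he]
        rw [add_mul, mul_add, mul_add, h1, h2, mul_add, mul_add, mul_assoc e b c]
        abel
      add_mem' := by
        rintro _ _ ⟨a, ha, b, hb, rfl⟩ ⟨c, hc', d, hd, rfl⟩
        exact ⟨a + c, O.add_mem ha hc', b + d, O.add_mem hb hd, by rw [mul_add]; abel⟩
      algebraMap_mem' := fun r => ⟨algebraMap _ A r, O.algebraMap_mem r, 0, O.zero_mem, by simp⟩ }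
  have hle : O ≤ O' := fun a ha => ⟨a, ha, 0, O.zero_mem, by simp⟩
  have hO' : IsOrder O' := by
    refine ⟨?_, ?_⟩
    · have h : Subalgebra.toSubmodule O' = Subalgebra.toSubmodule O ⊔
          (Subalgebra.toSubmodule O).map (LinearMap.mulLeft (ZS S) e) := by
        ext x
        rw [Submodule.mem_sup]
        constructor
        · rintro ⟨a, ha, b, hb, rfl⟩
          exact ⟨a, ha, e * b, ⟨b, hb, rfl⟩, rfl⟩
        · rintro ⟨a, ha, _, ⟨b, hb, rfl⟩, rfl⟩
          exact ⟨a, ha, b, hb, rfl⟩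
      rw [h]
      exact hO.1.1.sup (hO.1.1.map _)
    · exact top_le_iff.1 (hO.1.2 ▸ Submodule.span_mono hle)
  exact hO.2 hO' hle ⟨0, O.zero_mem, 1, O.one_mem, by simp⟩

/-! ### Finite modules -/

/-- The component `eM = {e m : m ∈ M}` of a module `M` over a ring `R`, for a central
element `e` of `R`, as an `R`-submodule of `M`. -/
def component {R : Type*} [Ring R] (e : R) (hc : ∀ r : R, e * r = r * e)
    (M : Type*) [AddCommGroup M] [Module R M] : Submodule R M where
  carrier := {x | ∃ y : M, e • y = x}
  add_mem' := by
    rintro _ _ ⟨a, rfl⟩ ⟨b, rfl⟩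
    exact ⟨a + b, smul_add _ _ _⟩
  zero_mem' := ⟨0, smul_zero _⟩
  smul_mem' := by
    rintro r _ ⟨a, rfl⟩
    exact ⟨r • a, by rw [smul_smul, hc, ← smul_smul]⟩

/-- `e_i G` for an irreducible central idempotent `e_i` of `A` and a module `G` over a maximal
order of `A`. -/
def irrComponent {O : Subalgebra (ZS S) A} (hO : IsMaximalOrder O) (i : IrrIdem A)
    (G : Type*) [AddCommGroup G] [Module O G] : Submodule O G :=
  component (⟨i.1, hO.mem i.2.idem i.2.central⟩ : O) (fun r => Subtype.ext (i.2.central r)) G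

/-- `|G|^u = ∏_i |e_i G|^{u_i}` (a positive real number if `G` is finite, here regarded as an
element of `[0, ∞]`). -/
def cardPow {O : Subalgebra (ZS S) A} (hO : IsMaximalOrder O) (u : IrrIdem A → ℚ)
    (G : Type*) [AddCommGroup G] [Module O G] : ℝ≥0∞ :=
  ∏ᶠ i : IrrIdem A, (Nat.card (irrComponent hO i G) : ℝ≥0∞) ^ ((u i : ℚ) : ℝ)

/-- `|Aut_R(G)|`. -/
def numAut (R : Type*) [Ring R] (G : Type*) [AddCommGroup G] [Module R G] : ℝ≥0∞ :=
  (Nat.card (G ≃ₗ[R] G) : ℝ≥0∞)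

/-- `|Sur_R(G, H)|`, the number of surjective `R`-module homomorphisms from `G` to `H`. -/
def numSur (R : Type*) [Ring R] (G H : Type*) [AddCommGroup G] [Module R G]
    [AddCommGroup H] [Module R H] : ℝ≥0∞ :=
  (Nat.card {f : G →ₗ[R] H // Function.Surjective f} : ℝ≥0∞)

/-! ### Random modules

A random `R`-module is a family `X ω` of `R`-modules indexed by the points of a discrete
probability space `(Ω, P)`. -/

/-- The probability `ℙ(X ≅ G)`. -/
def probIso (R : Type*) [Ring R] {Ω : Type*} (P : PMF Ω) (X : Ω → Type*)
    [∀ ω, AddCommGroup (X ω)] [∀ ω, Module R (X ω)]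
    (G : Type*) [AddCommGroup G] [Module R G] : ℝ≥0∞ :=
  P.toOuterMeasure {ω | Nonempty (X ω ≃ₗ[R] G)}

/-- The expected value `𝔼(f)` of a non-negative function on a discrete probability space. -/
def expect {Ω : Type*} (P : PMF Ω) (f : Ω → ℝ≥0∞) : ℝ≥0∞ := ∑' ω, P ω * f ω

/-- `X` is a random finite module `X(A, u, O)`: for all finite `O`-modules `G₁`, `G₂`,
`ℙ(X ≅ G₁) / ℙ(X ≅ G₂) = (|G₂|^u |Aut_O(G₂)|) / (|G₁|^u |Aut_O(G₁)|)`.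
(The right side is a positive real number, so this forces `0 < ℙ(X ≅ G₂)`. Every finite module is
isomorphic to one whose underlying set lives in `Type`.) -/
def IsCLMRandomModule {O : Subalgebra (ZS S) A} (hO : IsMaximalOrder O) (u : IrrIdem A → ℚ)
    {Ω : Type*} (P : PMF Ω) (X : Ω → Type*)
    [∀ ω, AddCommGroup (X ω)] [∀ ω, Module O (X ω)] : Prop :=
  (∀ ω, Finite (X ω)) ∧
  ∀ (G₁ G₂ : Type) [AddCommGroup G₁] [Module O G₁] [Finite G₁]
    [AddCommGroup G₂] [Module O G₂] [Finite G₂],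
    probIso O P X G₁ / probIso O P X G₂ =
      (cardPow hO u G₂ * numAut O G₂) / (cardPow hO u G₁ * numAut O G₁)

/-! ### Random modules over group rings -/

/-- The group ring `ℤ[|Γ|⁻¹, Γ]` of `Γ` over `ℤ[|Γ|⁻¹]`. -/
abbrev AwayGroupRing (Γ : Type*) [Group Γ] : Type _ :=
  MonoidAlgebra (Localization.Away (Nat.card Γ : ℤ)) Γ

/-- The subgroup `H^Δ` of `Δ`-invariants, for a subgroup `Δ` of `Γ`. -/
def invariants {Γ : Type*} [Group Γ] (Δ : Subgroup Γ)
    (H : Type*) [AddCommGroup H] [Module (AwayGroupRing Γ) H] : AddSubgroup H where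
  carrier := {x | ∀ γ ∈ Δ, (MonoidAlgebra.of (Localization.Away (Nat.card Γ : ℤ)) Γ γ) • x = x}
  add_mem' := by
    intro a b ha hb γ hγ
    rw [smul_add, ha γ hγ, hb γ hγ]
  zero_mem' := fun _ _ => smul_zero _
  neg_mem' := by
    intro a ha γ hγ
    rw [smul_neg, ha γ hγ]

/-- `X` is a random module with the Cohen-Lenstra-Martinet distribution for `Γ`-fields with
decomposition group `Γ∞` at infinity: it takes values in finite `ℤ[|Γ|⁻¹, Γ]`-modules without
nonzero `Γ`-invariants, and `ℙ(X ≅ H) = c / (|H^{Γ∞}| |Aut_Γ(H)|)` for every such `H`,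
for some constant `c`. -/
def IsCLMForGaloisFields {Γ : Type*} [Group Γ] (Γinf : Subgroup Γ)
    {Ω : Type*} (P : PMF Ω) (X : Ω → Type*)
    [∀ ω, AddCommGroup (X ω)] [∀ ω, Module (AwayGroupRing Γ) (X ω)] : Prop :=
  (∀ ω, Finite (X ω) ∧ invariants (⊤ : Subgroup Γ) (X ω) = ⊥) ∧
  ∃ c : ℝ≥0∞, ∀ (H : Type) [AddCommGroup H] [Module (AwayGroupRing Γ) H] [Finite H],
    invariants (⊤ : Subgroup Γ) H = ⊥ →
      probIso (AwayGroupRing Γ) P X H =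
        c / ((Nat.card (invariants Γinf H) : ℝ≥0∞) * numAut (AwayGroupRing Γ) H)

end CLM

end

noncomputable section

namespace CLM

/-! ### Counting extensions through a free presentation -/

section Counting

universe u v₁ v₂ v₃

variable {R : Type u} [Ring R]

/-! Both moment formulas are instances of `expect_numSur_eq`, where ℙ(X ≅ G) = c / (w(G)|Aut G|) for
a weight w multiplicative in short exact sequences. The surjections X → H are sorted by the
isomorphism class of their kernel K. Fix a presentation π : R^n → H. A surjection p : X → H, an
isomorphism K ≅ ker p and a lift R^n → X of π together amount to a map h : ker π → K and an
isomorphism from the pushout G_h of ker π → R^n along h onto X. Each p has |K|^n lifts of π. The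
expected number of isomorphisms G_h → X is ℙ(X ≅ G_h)|Aut G_h| = c / (w(K)w(H)), independently of h.
If there are exactly |K|^n maps h, the two factors |K|^n cancel. Dividing by |Aut K| and summing
over K leaves w(H)⁻¹ ∑ ℙ(X ≅ K) = w(H)⁻¹. The ring-theoretic content is thus `EulerOne`: |Hom(N, K)|
= |K|^n for N of finite index in R^n. Climb from N to R^n through covering pairs N ⋖ M, proving
along the way that N is projective, which reduces the count to simple K. For simple K, choose an
ideal a that kills K, whose multiplication preserves projectivity and covering pairs, and for which
modules killed by a are semisimple (`IsTwisting`). Either N + aM = M, and restriction Hom(M, K) →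
Hom(N, K) is bijective, or aM ≤ N, and M and N have the same factors modulo a, because M/N ≅ aM/aN.
Over ℤ[|Γ|⁻¹][Γ] the ideal (p), for p the prime killing K, works by Maschke's theorem. Over a
maximal order the annihilator of K works: it is an invertible ideal, by the classical argument with
a shortest product of primes inside (m) and the maximality of the order. The weights are
multiplicative because multiplication by an idempotent is exact, and so is taking invariants under a
group of invertible order. -/

/-- Surjections with kernel `Γ` are the same as isomorphisms from the quotient by `Γ`. -/
def surjWithKerEquiv {M : Type v₁} {G : Type v₂} [AddCommGroup M] [Module R M] [AddCommGroup G]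
    [Module R G] (Γ : Submodule R M) :
    {ψ : M →ₗ[R] G // Function.Surjective ψ ∧ LinearMap.ker ψ = Γ} ≃ ((M ⧸ Γ) ≃ₗ[R] G) where
  toFun ψ := (Submodule.quotEquivOfEq _ _ ψ.2.2.symm).trans
    (ψ.1.quotKerEquivOfSurjective ψ.2.1)
  invFun σ := ⟨σ.toLinearMap ∘ₗ Γ.mkQ, σ.surjective.comp Γ.mkQ_surjective, by
    rw [LinearMap.ker_comp, LinearEquiv.ker, ← LinearMap.ker, Submodule.ker_mkQ]⟩
  left_inv ψ := by
    ext x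
    simp
  right_inv σ := by
    ext x
    obtain ⟨x, rfl⟩ := Γ.mkQ_surjective x
    simp

/-- The number of lifts of a map from a free module along a surjection. -/
theorem card_lifts {n : ℕ} {G : Type v₁} {H : Type v₂} [AddCommGroup G] [Module R G]
    [AddCommGroup H] [Module R H] (p : G →ₗ[R] H) (hp : Function.Surjective p)
    (π : (Fin n → R) →ₗ[R] H) :
    Nat.card {φ : (Fin n → R) →ₗ[R] G // p ∘ₗ φ = π} = Nat.card (LinearMap.ker p) ^ n := by
  -- The lifts form a torsor under Hom(R^n, ker p), which is (ker p)^n.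
  obtain ⟨φ₀, hφ₀⟩ := Module.projective_lifting_property p π hp
  have e : ((Fin n → R) →ₗ[R] LinearMap.ker p) ≃ {φ : (Fin n → R) →ₗ[R] G // p ∘ₗ φ = π} :=
    { toFun := fun α => ⟨φ₀ + (LinearMap.ker p).subtype ∘ₗ α, by
        rw [LinearMap.comp_add, hφ₀, ← LinearMap.comp_assoc, LinearMap.comp_ker_subtype,
          LinearMap.zero_comp, add_zero]⟩
      invFun := fun φ => LinearMap.codRestrict _ (φ.1 - φ₀) fun x => by
        have h1 := LinearMap.congr_fun φ.2 x
        have h2 := LinearMap.congr_fun hφ₀ x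
        simp only [LinearMap.comp_apply] at h1 h2
        simp [h1, h2]
      left_inv := fun α => by ext; simp
      right_inv := fun φ => by ext; simp }
  rw [← Nat.card_congr e, ← Nat.card_congr ((Pi.basisFun R (Fin n)).constr ℕ).toEquiv,
    Nat.card_pi]
  simp

/-- The antidiagonal graph of a map `h` from a submodule `N` of `F` to `K`; the quotient of
`K × F` by it is the pushout of `N → F` along `h`. -/
def antigraph {F : Type v₁} {K : Type v₂} [AddCommGroup F] [Module R F] [AddCommGroup K]
    [Module R K] {N : Submodule R F} (h : N →ₗ[R] K) : Submodule R (K × F) :=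
  LinearMap.range ((-h).prod N.subtype)

theorem mem_antigraph {F : Type v₁} {K : Type v₂} [AddCommGroup F] [Module R F] [AddCommGroup K]
    [Module R K] {N : Submodule R F} (h : N →ₗ[R] K) (x : K × F) :
    x ∈ antigraph h ↔ ∃ hx : x.2 ∈ N, x.1 = - h ⟨x.2, hx⟩ := by
  constructor
  · rintro ⟨y, rfl⟩
    exact ⟨y.2, rfl⟩
  · rintro ⟨hx, h1⟩
    exact ⟨⟨x.2, hx⟩, Prod.ext h1.symm rfl⟩

section

variable {n : ℕ} {H : Type v₁} {K : Type v₂} {G : Type v₃} [AddCommGroup H] [Module R H]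
  [AddCommGroup K] [Module R K] [AddCommGroup G] [Module R G] (π : (Fin n → R) →ₗ[R] H)

/-- An extension of `H` by `K` with middle term `G` and a lift of the free presentation give a
presentation of `G` as a pushout. -/
def extensionToPresentation
    (b : Σ p : {p : G →ₗ[R] H // Function.Surjective p},
      (K ≃ₗ[R] LinearMap.ker p.1) × {φ : (Fin n → R) →ₗ[R] G // p.1 ∘ₗ φ = π}) :
    ((LinearMap.ker π) →ₗ[R] K) × (K × (Fin n → R) →ₗ[R] G) :=
  (b.2.1.symm.toLinearMap ∘ₗ LinearMap.codRestrict (LinearMap.ker b.1.1)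
      (b.2.2.1 ∘ₗ (LinearMap.ker π).subtype) (fun x => by
        have := LinearMap.congr_fun b.2.2.2 x.1
        simp only [LinearMap.comp_apply] at this
        simp [this]),
    LinearMap.coprod ((LinearMap.ker b.1.1).subtype ∘ₗ b.2.1.toLinearMap) b.2.2.1)

/-- The second component returns j and φ. They determine p: any g differs by an element of j(K),
where p vanishes, from some φ f, where p is π f. -/
theorem extensionToPresentation_injective (hπ : Function.Surjective π) :
    Function.Injective (extensionToPresentation (K := K) (G := G) π) := by
  rintro ⟨⟨p, hp⟩, j, φ, hφ⟩ ⟨⟨p', hp'⟩, j', φ', hφ'⟩ h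
  have h2 := congrArg Prod.snd h
  simp only [extensionToPresentation] at h2
  have hj : ∀ k, (j k : G) = j' k := fun k => by
    simpa using LinearMap.congr_fun h2 (k, 0)
  have hf : φ = φ' := LinearMap.ext fun f => by
    simpa using LinearMap.congr_fun h2 (0, f)
  subst hf
  have hpp : p = p' := by
    ext g
    obtain ⟨f, hf⟩ := hπ (p g)
    have h3 : p (φ f) = π f := LinearMap.congr_fun hφ f
    have h4 : p' (φ f) = π f := LinearMap.congr_fun hφ' f
    have h5 : g - φ f ∈ LinearMap.ker p := by
      rw [LinearMap.mem_ker, map_sub, h3, hf, sub_self]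
    obtain ⟨k, hk⟩ := j.surjective ⟨_, h5⟩
    have h6 : p' (g - φ f) = 0 := by
      have : (j' k : G) = g - φ f := by rw [← hj, hk]
      rw [← this]
      exact (j' k).2
    rw [map_sub, sub_eq_zero, h4] at h6
    rw [h6, hf]
  subst hpp
  have : j = j' := by
    ext k
    exact hj k
  subst this
  rfl

/-- Adding a lift φ to the inclusion of K presents G as (K × R^n) modulo the pairs (-h x, x) with x
in ker π. Conversely such a presentation gives back the extension, π descending to p and K embedding
as ker p. -/
theorem range_extensionToPresentation (hπ : Function.Surjective π) :
    Set.range (extensionToPresentation (K := K) (G := G) π) =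
      {x | Function.Surjective x.2 ∧ LinearMap.ker x.2 = antigraph x.1} := by
  ext ⟨h, ψ⟩
  constructor
  · rintro ⟨⟨⟨p, hp⟩, j, φ, hφ⟩, hb⟩
    have h3 : ∀ f, p (φ f) = π f := fun f => LinearMap.congr_fun hφ f
    simp only [extensionToPresentation, Prod.mk.injEq] at hb
    obtain ⟨rfl, rfl⟩ := hb
    refine ⟨fun g => ?_, ?_⟩
    · obtain ⟨f, hf⟩ := hπ (p g)
      have h5 : g - φ f ∈ LinearMap.ker p := by
        rw [LinearMap.mem_ker, map_sub, h3, hf, sub_self]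
      obtain ⟨k, hk⟩ := j.surjective ⟨_, h5⟩
      exact ⟨(k, f), by simp [hk]⟩
    · ext ⟨k, f⟩
      rw [mem_antigraph, LinearMap.mem_ker]
      constructor
      · intro hkf
        have hkf' : (j k : G) + φ f = 0 := by simpa using hkf
        have hf : f ∈ LinearMap.ker π := by
          rw [LinearMap.mem_ker, ← h3, ← neg_eq_of_add_eq_zero_right hkf', map_neg,
            LinearMap.mem_ker.1 (j k).2, neg_zero]
        refine ⟨hf, ?_⟩
        change k = -(j.symm _)
        rw [← map_neg, LinearEquiv.eq_symm_apply]
        ext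
        exact eq_neg_of_add_eq_zero_left hkf'
      · rintro ⟨hf, hk⟩
        change k = -(j.symm _) at hk
        rw [← map_neg, LinearEquiv.eq_symm_apply] at hk
        have : (j k : G) = -(φ f) := congrArg Subtype.val hk
        simp [this]
  · rintro ⟨hs, hk⟩
    simp only at hs hk
    have hmem := fun x => (SetLike.ext_iff.1 hk x).trans (mem_antigraph h x)
    have hle : LinearMap.ker ψ ≤ LinearMap.ker (π ∘ₗ LinearMap.snd R K (Fin n → R)) :=
      fun x hx => ((hmem x).1 hx).1
    let p : G →ₗ[R] H := (LinearMap.ker ψ).liftQ (π ∘ₗ LinearMap.snd R K (Fin n → R)) hle ∘ₗ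
      (ψ.quotKerEquivOfSurjective hs).symm.toLinearMap
    have hp : ∀ x, p (ψ x) = π x.2 := fun x => by
      have : (ψ.quotKerEquivOfSurjective hs).symm (ψ x) = (LinearMap.ker ψ).mkQ x := by
        rw [LinearEquiv.symm_apply_eq]
        rfl
      simp only [p, LinearMap.comp_apply, LinearEquiv.coe_coe, this]
      rfl
    have hps : Function.Surjective p := fun y => by
      obtain ⟨f, rfl⟩ := hπ y
      exact ⟨ψ (0, f), hp _⟩
    -- Injective since (k, 0) in the antigraph forces k = -h 0. Surjective since for f in ker π the
    -- pairs (k, f) and (k + h f, 0) are congruent.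
    let j₀ : K →ₗ[R] LinearMap.ker p := LinearMap.codRestrict _ (ψ ∘ₗ LinearMap.inl R K _)
      fun k => by
        rw [LinearMap.mem_ker]
        simp [hp]
    have hj₀ : Function.Bijective j₀ := by
      constructor
      · rw [← LinearMap.ker_eq_bot, LinearMap.ker_eq_bot']
        intro k hk0
        have : ψ (k, 0) = 0 := congrArg Subtype.val hk0
        obtain ⟨h0, h1⟩ := (hmem _).1 (LinearMap.mem_ker.2 this)
        simp only at h1
        rw [h1, neg_eq_zero]
        exact map_zero h
      · rintro ⟨g, hg⟩
        obtain ⟨⟨k, f⟩, rfl⟩ := hs g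
        rw [LinearMap.mem_ker, hp] at hg
        refine ⟨k + h ⟨f, hg⟩, ?_⟩
        ext
        change ψ (k + h ⟨f, hg⟩, 0) = ψ (k, f)
        rw [← sub_eq_zero, ← map_sub, ← LinearMap.mem_ker, hmem]
        refine ⟨by simpa using hg, ?_⟩
        have : (⟨(0 : Fin n → R) - f, by simpa using hg⟩ : LinearMap.ker π) = -⟨f, hg⟩ := by
          ext1
          simp
        simp only [Prod.mk_sub_mk, this, map_neg, neg_neg, add_sub_cancel_left]
    refine ⟨⟨⟨p, hps⟩, LinearEquiv.ofBijective j₀ hj₀, ψ ∘ₗ LinearMap.inr R K _, ?_⟩, ?_⟩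
    · ext f
      simp [hp]
    · refine Prod.ext ?_ ?_
      · ext x
        change (LinearEquiv.ofBijective j₀ hj₀).symm _ = _
        rw [LinearEquiv.symm_apply_eq]
        ext
        change ψ (0, x.1) = ψ (h x, 0)
        rw [← sub_eq_zero, ← map_sub, ← LinearMap.mem_ker, hmem]
        refine ⟨by simp, ?_⟩
        simp
      · refine LinearMap.ext fun x => ?_
        change ψ (x.1, 0) + ψ (0, x.2) = ψ x
        rw [← map_add]
        simp

theorem tsum_natCard {α : Type*} {β : α → Type*} [Finite α] [∀ a, Finite (β a)] :
    ∑' a, (Nat.card (β a) : ℝ≥0∞) = (Nat.card (Σ a, β a) : ℝ≥0∞) := by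
  have := Fintype.ofFinite α
  rw [tsum_fintype, Nat.card_sigma, Nat.cast_sum]

/-- Double count of triples (p, K ≅ ker p, lift of π): the lifts contribute the factor |K|^n on the
left, and grouping by the induced map h gives the pushouts on the right. -/
theorem card_extension_mul (hπ : Function.Surjective π) [Finite K] [Finite G] [Finite H]
    [Finite ((LinearMap.ker π) →ₗ[R] K)] :
    (∑' p : {p : G →ₗ[R] H // Function.Surjective p},
      (Nat.card (K ≃ₗ[R] LinearMap.ker p.1) : ℝ≥0∞)) * (Nat.card K : ℝ≥0∞) ^ n =
    ∑' h : (LinearMap.ker π) →ₗ[R] K,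
      (Nat.card ((((K × (Fin n → R)) ⧸ antigraph h)) ≃ₗ[R] G) : ℝ≥0∞) := by
  have hfin : Finite ((Fin n → R) →ₗ[R] G) :=
    Finite.of_equiv _ ((Pi.basisFun R (Fin n)).constr ℕ).toEquiv
  have : Finite (K →ₗ[R] G) := DFunLike.finite _
  have hfin' : Finite (K × (Fin n → R) →ₗ[R] G) :=
    Finite.of_equiv _ (LinearMap.coprodEquiv ℕ).toEquiv
  have : Finite (G →ₗ[R] H) := DFunLike.finite _
  have : ∀ p : G →ₗ[R] H, Finite (K ≃ₗ[R] LinearMap.ker p) := fun p => DFunLike.finite _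
  have h1 : ∀ p : {p : G →ₗ[R] H // Function.Surjective p},
      (Nat.card (K ≃ₗ[R] LinearMap.ker p.1) : ℝ≥0∞) * (Nat.card K : ℝ≥0∞) ^ n =
        (Nat.card ((K ≃ₗ[R] LinearMap.ker p.1) ×
          {φ : (Fin n → R) →ₗ[R] G // p.1 ∘ₗ φ = π}) : ℝ≥0∞) := fun p => by
    rw [Nat.card_prod, card_lifts _ p.2, Nat.cast_mul, Nat.cast_pow]
    -- There are |ker p|^n lifts; this is |K|^n as soon as an isomorphism K ≅ ker p exists, and
    -- otherwise both sides vanish.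
    rcases isEmpty_or_nonempty (K ≃ₗ[R] LinearMap.ker p.1) with h | ⟨⟨j⟩⟩
    · simp
    · rw [Nat.card_congr j.toEquiv]
  have h2 : ∀ h : (LinearMap.ker π) →ₗ[R] K,
      (Nat.card ((((K × (Fin n → R)) ⧸ antigraph h)) ≃ₗ[R] G) : ℝ≥0∞) =
      (Nat.card {ψ : K × (Fin n → R) →ₗ[R] G //
        Function.Surjective ψ ∧ LinearMap.ker ψ = antigraph h} : ℝ≥0∞) := fun h => by
    rw [Nat.card_congr (surjWithKerEquiv _)]
  rw [← ENNReal.tsum_mul_right, tsum_congr h1, tsum_congr h2, tsum_natCard, tsum_natCard]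
  congr 1
  rw [Nat.card_congr (Equiv.ofInjective _ (extensionToPresentation_injective π hπ)),
    range_extensionToPresentation π hπ]
  exact Nat.card_congr (Equiv.subtypeProdEquivSigmaSubtype
    (fun (h : (LinearMap.ker π) →ₗ[R] K) (ψ : K × (Fin n → R) →ₗ[R] G) =>
      Function.Surjective ψ ∧ LinearMap.ker ψ = antigraph h))

end
end Counting
end CLM

namespace CLM

/-! ### Counting isomorphisms and isomorphism classes -/

section Moments

universe u v₁ v₂ v₃

variable {R : Type u} [Ring R]

variable (R) in
/-- Every submodule of finite index in a free module `R ^ n` has as many homomorphisms to each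
finite module as `R ^ n` itself (equivalently `Hom` and `Ext¹` of finite modules have the same
size). -/
def EulerOne : Prop :=
  ∀ (n : ℕ) (N : Submodule R (Fin n → R)), Finite ((Fin n → R) ⧸ N) →
    ∀ (K : Type) [AddCommGroup K] [Module R K] [Finite K],
      Nat.card (N →ₗ[R] K) = Nat.card K ^ n

theorem natCard_equiv_eq_numAut {G : Type v₁} {G' : Type v₂} [AddCommGroup G] [Module R G]
    [AddCommGroup G'] [Module R G'] (e : G' ≃ₗ[R] G) :
    (Nat.card (G ≃ₗ[R] G') : ℝ≥0∞) = numAut R G := by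
  rw [numAut, Nat.card_congr (⟨fun f => f.trans e, fun f => f.trans e.symm, fun f => by
    ext; simp, fun f => by ext; simp⟩ : (G ≃ₗ[R] G') ≃ (G ≃ₗ[R] G))]

theorem numAut_congr {G : Type v₁} {G' : Type v₂} [AddCommGroup G] [Module R G]
    [AddCommGroup G'] [Module R G'] (e : G ≃ₗ[R] G') : numAut R G = numAut R G' := by
  rw [← natCard_equiv_eq_numAut e.symm, numAut, Nat.card_congr
    (⟨fun f => e.symm.trans f, fun f => e.trans f, fun f => by
    ext; simp, fun f => by ext; simp⟩ : (G ≃ₗ[R] G') ≃ (G' ≃ₗ[R] G'))]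

theorem numSur_congr {G : Type v₁} {G' : Type v₂} {H : Type v₃} [AddCommGroup G] [Module R G]
    [AddCommGroup G'] [Module R G'] [AddCommGroup H] [Module R H] (e : G ≃ₗ[R] G') :
    numSur R G H = numSur R G' H := by
  rw [numSur, numSur, Nat.card_congr
    (⟨fun f => ⟨f.1 ∘ₗ e.symm.toLinearMap, f.2.comp e.symm.surjective⟩,
      fun f => ⟨f.1 ∘ₗ e.toLinearMap, f.2.comp e.surjective⟩,
      fun f => by ext; simp, fun f => by ext; simp⟩ :
      {f : G →ₗ[R] H // Function.Surjective f} ≃ {f : G' →ₗ[R] H // Function.Surjective f})]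

theorem numSur_congr_right {G : Type v₁} {H : Type v₂} {H' : Type v₃} [AddCommGroup G]
    [Module R G] [AddCommGroup H] [Module R H] [AddCommGroup H'] [Module R H'] (e : H ≃ₗ[R] H') :
    numSur R G H = numSur R G H' := by
  rw [numSur, numSur, Nat.card_congr
    (⟨fun f => ⟨e.toLinearMap ∘ₗ f.1, e.surjective.comp f.2⟩,
      fun f => ⟨e.symm.toLinearMap ∘ₗ f.1, e.symm.surjective.comp f.2⟩,
      fun f => by ext; simp, fun f => by ext; simp⟩ :
      {f : G →ₗ[R] H // Function.Surjective f} ≃ {f : G →ₗ[R] H' // Function.Surjective f})]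

theorem numAut_ne_zero (G : Type v₁) [AddCommGroup G] [Module R G] [Finite G] :
    numAut R G ≠ 0 := by
  have : Finite (G ≃ₗ[R] G) := DFunLike.finite _
  have : Nonempty (G ≃ₗ[R] G) := ⟨.refl _ _⟩
  exact Nat.cast_ne_zero.2 Nat.card_pos.ne'

theorem numAut_ne_top (G : Type v₁) [AddCommGroup G] [Module R G] : numAut R G ≠ ⊤ :=
  ENNReal.natCast_ne_top _

variable {Ω : Type v₁} (P : PMF Ω) (X : Ω → Type v₂) [∀ ω, AddCommGroup (X ω)]
  [∀ ω, Module R (X ω)]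

/-- The isomorphisms G → X form an empty set or an Aut(G)-torsor, so |Iso(G, X)| / |Aut G| is the
indicator of X ≅ G. -/
theorem probIso_eq_tsum (G : Type v₃) [AddCommGroup G] [Module R G] [Finite G] :
    probIso R P X G = ∑' ω, P ω * ((Nat.card (G ≃ₗ[R] X ω) : ℝ≥0∞) * (numAut R G)⁻¹) := by
  rw [probIso, PMF.toOuterMeasure_apply]
  refine tsum_congr fun ω => ?_
  by_cases h : Nonempty (X ω ≃ₗ[R] G)
  · rw [Set.indicator_of_mem (by exact h), natCard_equiv_eq_numAut h.some,
      ENNReal.mul_inv_cancel (numAut_ne_zero G) (numAut_ne_top G), mul_one]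
  · have : IsEmpty (G ≃ₗ[R] X ω) := ⟨fun e => h ⟨e.symm⟩⟩
    rw [Set.indicator_of_notMem (by exact h)]
    simp

theorem tsum_mul_natCard_equiv (G : Type v₃) [AddCommGroup G] [Module R G] [Finite G] :
    ∑' ω, P ω * (Nat.card (G ≃ₗ[R] X ω) : ℝ≥0∞) = probIso R P X G * numAut R G := by
  rw [probIso_eq_tsum, ← ENNReal.tsum_mul_right]
  refine tsum_congr fun ω => ?_
  rw [mul_assoc, mul_assoc, ENNReal.inv_mul_cancel (numAut_ne_zero G) (numAut_ne_top G), mul_one]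

theorem probIso_congr {Y : Ω → Type v₃} [∀ ω, AddCommGroup (Y ω)] [∀ ω, Module R (Y ω)]
    (e : ∀ ω, X ω ≃ₗ[R] Y ω) {G G' : Type*} [AddCommGroup G] [Module R G] [AddCommGroup G']
    [Module R G'] (e' : G ≃ₗ[R] G') : probIso R P X G = probIso R P Y G' := by
  rw [probIso, probIso]
  congr 1
  ext ω
  exact ⟨fun ⟨f⟩ => ⟨(e ω).symm.trans (f.trans e')⟩, fun ⟨f⟩ => ⟨(e ω).trans (f.trans e'.symm)⟩⟩

/-- A bundled finite module satisfying a predicate `C`. -/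
structure FinMod (R : Type u) [Ring R]
    (C : ∀ (G : Type) [AddCommGroup G] [Module R G], Prop) : Type (max u 1) where
  /-- The underlying type. -/
  carrier : Type
  [grp : AddCommGroup carrier]
  [mod : Module R carrier]
  [fin : Finite carrier]
  prop : C carrier

attribute [instance] FinMod.grp FinMod.mod FinMod.fin

/-- Isomorphism of bundled finite modules. -/
def FinMod.isoSetoid (R : Type u) [Ring R]
    (C : ∀ (G : Type) [AddCommGroup G] [Module R G], Prop) : Setoid (FinMod R C) where
  r K L := Nonempty (K.carrier ≃ₗ[R] L.carrier)
  iseqv := ⟨fun _ => ⟨.refl _ _⟩, fun ⟨e⟩ => ⟨e.symm⟩, fun ⟨e⟩ ⟨f⟩ => ⟨e.trans f⟩⟩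

/-- Isomorphism classes of finite modules. -/
def FinModClass (R : Type u) [Ring R]
    (C : ∀ (G : Type) [AddCommGroup G] [Module R G], Prop) : Type (max u 1) :=
  Quotient (FinMod.isoSetoid R C)

/-- A representative of an isomorphism class. -/
def FinModClass.rep {C : ∀ (G : Type) [AddCommGroup G] [Module R G], Prop}
    (k : FinModClass R C) : FinMod R C := Quotient.out k

/-- Every finite module is isomorphic to exactly one representative. -/
theorem tsum_class_natCard {C : ∀ (G : Type) [AddCommGroup G] [Module R G], Prop}
    (G : Type) [AddCommGroup G] [Module R G] [Finite G] (hG : C G) :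
    ∑' k : FinModClass R C,
      ((Nat.card (k.rep.carrier ≃ₗ[R] G) : ℝ≥0∞) * (numAut R k.rep.carrier)⁻¹) = 1 := by
  let k₀ : FinModClass R C := Quotient.mk (FinMod.isoSetoid R C) ⟨G, hG⟩
  have h₀ : Nonempty (k₀.rep.carrier ≃ₗ[R] G) :=
    @Quotient.mk_out _ (FinMod.isoSetoid R C) ⟨G, hG⟩
  rw [tsum_eq_single k₀]
  · rw [natCard_equiv_eq_numAut h₀.some.symm,
      ENNReal.mul_inv_cancel (numAut_ne_zero _) (numAut_ne_top _)]
  · intro k hk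
    have : IsEmpty (k.rep.carrier ≃ₗ[R] G) := ⟨fun e => hk <| by
      rw [← Quotient.out_eq k]
      exact @Quotient.sound _ (FinMod.isoSetoid R C) _ _ ⟨e⟩⟩
    simp

end Moments

/-! ### The moment formula for a multiplicative weight -/

section Moments

universe u v₁

variable {R : Type u} [Ring R] {Ω : Type v₁} (P : PMF Ω) (X : Ω → Type) [∀ ω, AddCommGroup (X ω)]
  [∀ ω, Module R (X ω)]

/-- The quotient map onto the pushout is itself a presentation of the kind described by
`range_extensionToPresentation`, so it comes from an extension of H by K. -/
theorem exists_exact_antigraph {n : ℕ} {H K : Type} [AddCommGroup H] [Module R H]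
    [AddCommGroup K] [Module R K] [Finite K] [Finite H]
    (π : (Fin n → R) →ₗ[R] H) (hπ : Function.Surjective π) (h : LinearMap.ker π →ₗ[R] K) :
    Finite ((K × (Fin n → R)) ⧸ antigraph h) ∧
    ∃ (i : K →ₗ[R] ((K × (Fin n → R)) ⧸ antigraph h))
      (p : ((K × (Fin n → R)) ⧸ antigraph h) →ₗ[R] H),
      Function.Injective i ∧ Function.Surjective p ∧ Function.Exact i p := by
  have hmem : (h, (antigraph h).mkQ) ∈ Set.range
      (extensionToPresentation (K := K) (G := (K × (Fin n → R)) ⧸ antigraph h) π) := by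
    rw [range_extensionToPresentation π hπ]
    exact ⟨Submodule.mkQ_surjective _, Submodule.ker_mkQ _⟩
  obtain ⟨⟨⟨p, hp⟩, j, -⟩, -⟩ := hmem
  refine ⟨?_, (LinearMap.ker p).subtype ∘ₗ j.toLinearMap, p,
    (Submodule.injective_subtype _).comp j.injective, hp, fun x => ?_⟩
  · have hs : ∀ g, g - Function.surjInv hp (p g) ∈ LinearMap.ker p := fun g => by
      rw [LinearMap.mem_ker, map_sub, Function.surjInv_eq hp, sub_self]
    refine Finite.of_injective (fun g => (p g, j.symm ⟨_, hs g⟩)) fun g g' hg => ?_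
    simp only [Prod.mk.injEq, EmbeddingLike.apply_eq_iff_eq, Subtype.mk.injEq] at hg
    rw [hg.1] at hg
    exact sub_left_injective hg.2
  · constructor
    · intro hx
      exact ⟨j.symm ⟨x, hx⟩, by simp⟩
    · rintro ⟨k, rfl⟩
      exact (j k).2

/-- The moments of a random module whose distribution is inversely proportional to the number of
automorphisms and to a weight `w` which is multiplicative in short exact sequences. -/
theorem expect_numSur_eq (hR : EulerOne R)
    (C : ∀ (G : Type) [AddCommGroup G] [Module R G], Prop)
    (w : ∀ (G : Type) [AddCommGroup G] [Module R G], ℝ≥0∞)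
    (hw : ∀ (G : Type) [AddCommGroup G] [Module R G] [Finite G], w G ≠ 0 ∧ w G ≠ ⊤)
    (hw_exact : ∀ (K G H : Type) [AddCommGroup K] [Module R K] [AddCommGroup G] [Module R G]
      [AddCommGroup H] [Module R H] [Finite K] [Finite G] [Finite H]
      (i : K →ₗ[R] G) (p : G →ₗ[R] H), Function.Injective i → Function.Surjective p →
      Function.Exact i p → w G = w K * w H)
    (hC_ext : ∀ (K G H : Type) [AddCommGroup K] [Module R K] [AddCommGroup G] [Module R G]
      [AddCommGroup H] [Module R H] [Finite K] [Finite G] [Finite H]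
      (i : K →ₗ[R] G) (p : G →ₗ[R] H), Function.Injective i → Function.Surjective p →
      Function.Exact i p → C K → C H → C G)
    (hC_sub : ∀ (K G : Type) [AddCommGroup K] [Module R K] [AddCommGroup G] [Module R G]
      [Finite G] (i : K →ₗ[R] G), Function.Injective i → C G → C K)
    (hX : ∀ ω, Finite (X ω) ∧ C (X ω)) (c : ℝ≥0∞)
    (hP : ∀ (G : Type) [AddCommGroup G] [Module R G] [Finite G], C G →
      probIso R P X G = c / (w G * numAut R G))
    (H : Type) [AddCommGroup H] [Module R H] [Finite H] (hH : C H) :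
    expect P (fun ω => numSur R (X ω) H) = (w H)⁻¹ := by
  have := fun ω => (hX ω).1
  obtain ⟨n, π, hπ⟩ := Module.Finite.exists_fin' R H
  have hfin : Finite ((Fin n → R) ⧸ LinearMap.ker π) :=
    Finite.of_equiv _ (π.quotKerEquivOfSurjective hπ).symm.toEquiv
  -- The expected number of pairs (p, K ≅ ker p), for a fixed kernel type K.
  have key : ∀ (K : Type) [AddCommGroup K] [Module R K] [Finite K], C K →
      ∑' ω, P ω * ∑' p : {p : X ω →ₗ[R] H // Function.Surjective p},
        (Nat.card (K ≃ₗ[R] LinearMap.ker p.1) : ℝ≥0∞) = (w H)⁻¹ * (c / w K) := by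
    intro K _ _ _ hK
    have hcard := hR n _ hfin K
    have hpos : Nat.card K ^ n ≠ 0 := pow_ne_zero _ Nat.card_pos.ne'
    have : Finite (LinearMap.ker π →ₗ[R] K) := Nat.finite_of_card_ne_zero (hcard ▸ hpos)
    have hpos' : ((Nat.card K : ℝ≥0∞) ^ n) ≠ 0 := by exact_mod_cast hpos
    have htop : ((Nat.card K : ℝ≥0∞) ^ n) ≠ ⊤ := ENNReal.pow_ne_top (ENNReal.natCast_ne_top _)
    have hG : ∀ h : LinearMap.ker π →ₗ[R] K,
        ∑' ω, P ω * (Nat.card (((K × (Fin n → R)) ⧸ antigraph h) ≃ₗ[R] X ω) : ℝ≥0∞) =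
          (w H)⁻¹ * (c / w K) := by
      intro h
      obtain ⟨hfinG, i, p, hi, hp, hip⟩ := exists_exact_antigraph π hπ h
      -- The hypotheses on `C`, `w` and the probabilities concern modules in `Type`, while the
      -- pushout lives in the universe of R; being finite, it has a copy in `Type`.
      let e := Shrink.linearEquiv.{0} R ((K × (Fin n → R)) ⧸ antigraph h)
      have hi' : Function.Injective (e.symm.toLinearMap ∘ₗ i) := e.symm.injective.comp hi
      have hp' : Function.Surjective (p ∘ₗ e.toLinearMap) := hp.comp e.surjective
      have hip' : Function.Exact (e.symm.toLinearMap ∘ₗ i) (p ∘ₗ e.toLinearMap) := by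
        intro x
        have := hip (e x)
        simp only [LinearMap.comp_apply, LinearEquiv.coe_coe, this, Set.mem_range,
          LinearEquiv.symm_apply_eq]
      have hfinS : Finite (Shrink.{0} ((K × (Fin n → R)) ⧸ antigraph h)) :=
        Finite.of_equiv _ e.symm.toEquiv
      rw [tsum_mul_natCard_equiv, probIso_congr P X (fun ω => .refl R (X ω)) e.symm,
        numAut_congr e.symm, hP _ (hC_ext _ _ _ _ _ hi' hp' hip' hK hH),
        hw_exact _ _ _ _ _ hi' hp' hip']
      have hA := numAut_ne_zero (R := R) (Shrink.{0} ((K × (Fin n → R)) ⧸ antigraph h))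
      have hA' := numAut_ne_top (R := R) (Shrink.{0} ((K × (Fin n → R)) ⧸ antigraph h))
      rw [ENNReal.div_eq_inv_mul, ENNReal.mul_inv (.inr hA') (.inr hA),
        ENNReal.mul_inv (.inl (hw K).1) (.inl (hw K).2), ENNReal.div_eq_inv_mul]
      calc _ = ((w K)⁻¹ * (w H)⁻¹ * c) * ((numAut R _)⁻¹ * numAut R _) := by ring
        _ = _ := by rw [ENNReal.inv_mul_cancel hA hA']; ring
    have : (∑' ω, P ω * ∑' p : {p : X ω →ₗ[R] H // Function.Surjective p},
        (Nat.card (K ≃ₗ[R] LinearMap.ker p.1) : ℝ≥0∞)) * (Nat.card K : ℝ≥0∞) ^ n =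
        ((w H)⁻¹ * (c / w K)) * (Nat.card K : ℝ≥0∞) ^ n := by
      rw [← ENNReal.tsum_mul_right]
      simp_rw [mul_assoc (P _), card_extension_mul π hπ, ← ENNReal.tsum_mul_left]
      -- All h contribute equally, and by `EulerOne` there are |K|^n of them, the same factor as on
      -- the left.
      rw [ENNReal.tsum_comm, tsum_congr hG, ENNReal.tsum_const, ENat.card_eq_coe_natCard, hcard]
      push_cast
      ring
    exact (ENNReal.mul_left_inj hpos' htop).1 this
  -- Each surjection is counted through the unique class of its kernel; the kernel satisfies `C` by
  -- closure under submodules.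
  have hsur : ∀ ω, numSur R (X ω) H = ∑' k : FinModClass R C,
      (numAut R k.rep.carrier)⁻¹ * ∑' p : {p : X ω →ₗ[R] H // Function.Surjective p},
        (Nat.card (k.rep.carrier ≃ₗ[R] LinearMap.ker p.1) : ℝ≥0∞) := by
    intro ω
    have : Finite (X ω →ₗ[R] H) := DFunLike.finite _
    simp_rw [← ENNReal.tsum_mul_left]
    rw [ENNReal.tsum_comm]
    simp_rw [mul_comm _ (Nat.card _ : ℝ≥0∞)]
    rw [tsum_congr fun p : {p : X ω →ₗ[R] H // Function.Surjective p} =>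
      tsum_class_natCard (C := C) (LinearMap.ker p.1)
        (hC_sub _ _ (LinearMap.ker p.1).subtype (Submodule.injective_subtype _) (hX ω).2)]
    rw [ENNReal.tsum_const, ENat.card_eq_coe_natCard, mul_one, numSur]
    rfl
  -- X takes values in modules satisfying `C`, so the classes exhaust the total probability.
  have hone : ∑' k : FinModClass R C, probIso R P X k.rep.carrier = 1 := by
    simp_rw [probIso_eq_tsum]
    rw [ENNReal.tsum_comm]
    simp_rw [ENNReal.tsum_mul_left]
    rw [tsum_congr fun ω => by rw [tsum_class_natCard (C := C) (X ω) (hX ω).2, mul_one]]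
    exact P.tsum_coe
  rw [expect]
  simp_rw [hsur]
  rw [tsum_congr fun ω => ENNReal.tsum_mul_left.symm, ENNReal.tsum_comm]
  have : ∀ k : FinModClass R C, ∑' ω, P ω * ((numAut R k.rep.carrier)⁻¹ *
      ∑' p : {p : X ω →ₗ[R] H // Function.Surjective p},
        (Nat.card (k.rep.carrier ≃ₗ[R] LinearMap.ker p.1) : ℝ≥0∞)) =
      (w H)⁻¹ * probIso R P X k.rep.carrier := by
    intro k
    simp_rw [mul_left_comm (P _)]
    rw [ENNReal.tsum_mul_left, key _ k.rep.prop, hP _ k.rep.prop, ENNReal.div_eq_inv_mul,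
      ENNReal.div_eq_inv_mul, ENNReal.mul_inv (.inl (hw _).1) (.inl (hw _).2)]
    ring
  rw [tsum_congr this, ENNReal.tsum_mul_left, hone, mul_one]

end Moments
end CLM

namespace CLM

/-! ### Lattices in free modules -/

section Lattices

universe u v w

variable {R : Type u} [Ring R] {V : Type v} [AddCommGroup V] [Module R V] {K : Type w}
  [AddCommGroup K] [Module R K]

theorem natCard_eq_card_ker_mul_card_range {A B : Type*} [AddGroup A] [AddGroup B] (f : A →+ B) :
    Nat.card A = Nat.card f.ker * Nat.card f.range := by
  rw [← f.ker.card_mul_index, AddSubgroup.index_ker]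

/-- Homomorphisms out of a quotient. -/
def quotientHomEquiv (D : Submodule R V) :
    ((V ⧸ D) →ₗ[R] K) ≃ {f : V →ₗ[R] K // ∀ x ∈ D, f x = 0} where
  toFun f := ⟨f ∘ₗ D.mkQ, fun x hx => by simp [(Submodule.Quotient.mk_eq_zero D).2 hx]⟩
  invFun f := D.liftQ f.1 f.2
  left_inv f := by ext; rfl
  right_inv f := by ext; rfl

/-- Extension of a homomorphism along `A ≤ B`, if it vanishes on `A ∩ D` and `B / D` is
semisimple. -/
theorem exists_extension {A B D : Submodule R V} (hAB : A ≤ B)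
    (hss : IsSemisimpleModule R (B ⧸ D.submoduleOf B)) (g : A →ₗ[R] K)
    (hg : ∀ x : A, (x : V) ∈ D → g x = 0) :
    ∃ f : B →ₗ[R] K, (∀ x : A, f (Submodule.inclusion hAB x) = g x) ∧
      ∀ x : B, (x : V) ∈ D → f x = 0 := by
  let q : A →ₗ[R] B ⧸ D.submoduleOf B := (D.submoduleOf B).mkQ ∘ₗ Submodule.inclusion hAB
  have hq : LinearMap.ker q ≤ LinearMap.ker g := fun x hx => by
    have : Submodule.inclusion hAB x ∈ D.submoduleOf B :=
      (Submodule.Quotient.mk_eq_zero _).1 (LinearMap.mem_ker.1 hx)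
    exact hg x this
  obtain ⟨f, hf⟩ := IsSemisimpleModule.extension_property ((LinearMap.ker q).liftQ q le_rfl)
    (LinearMap.ker_eq_bot.1 (Submodule.ker_liftQ_eq_bot _ _ _ le_rfl))
    ((LinearMap.ker q).liftQ g hq)
  refine ⟨f ∘ₗ (D.submoduleOf B).mkQ, fun x => ?_, fun x hx => ?_⟩
  · have := LinearMap.congr_fun hf (Submodule.Quotient.mk x)
    simpa [q] using this
  · have : (D.submoduleOf B).mkQ x = 0 := (Submodule.Quotient.mk_eq_zero _).2 hx
    rw [LinearMap.comp_apply, this, map_zero]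

/-- For `A ≤ B` with `B / D` semisimple, where `D` is killed by all maps to `K`,
`|Hom(B, K)| = |Hom(B / A, K)| |Hom(A / D, K)|`. -/
theorem card_hom_eq_mul {A B D : Submodule R V} (hAB : A ≤ B)
    (hss : IsSemisimpleModule R (B ⧸ D.submoduleOf B))
    (hD : ∀ (f : B →ₗ[R] K) (x : B), (x : V) ∈ D → f x = 0) :
    Nat.card (B →ₗ[R] K) = Nat.card ((B ⧸ A.submoduleOf B) →ₗ[R] K) *
      Nat.card ((A ⧸ D.submoduleOf A) →ₗ[R] K) := by
  -- The kernel of restriction to A is Hom(B/A, K). Its image consists of all maps vanishing on A ∩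
  -- D, since those extend by semisimplicity of B/D.
  let ρ : (B →ₗ[R] K) →+ (A →ₗ[R] K) :=
    { toFun := fun f => f ∘ₗ Submodule.inclusion hAB
      map_zero' := rfl
      map_add' := fun _ _ => rfl }
  rw [natCard_eq_card_ker_mul_card_range ρ, Nat.card_congr (quotientHomEquiv _),
    Nat.card_congr (quotientHomEquiv _)]
  congr 1
  · refine Nat.card_congr (Equiv.subtypeEquivRight fun f => ?_)
    rw [AddMonoidHom.mem_ker]
    constructor
    · intro h x hx
      exact LinearMap.congr_fun h ⟨x.1, hx⟩
    · intro h
      ext x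
      exact h (Submodule.inclusion hAB x) x.2
  · refine Nat.card_congr (Equiv.subtypeEquivRight fun g => ?_)
    constructor
    · rintro ⟨f, rfl⟩ x hx
      exact hD f _ hx
    · intro h
      obtain ⟨f, hf, -⟩ := exists_extension hAB hss g fun x hx => h x hx
      exact ⟨f, LinearMap.ext hf⟩

/-- If `D ≤ N ≤ M`, where `M / D` is semisimple and `M` and `D` are projective, then `N` is
projective. -/
theorem projective_of_semisimple_quotient {M N D : Submodule R V} (hNM : N ≤ M) (hDN : D ≤ N)
    (hss : IsSemisimpleModule R (M ⧸ D.submoduleOf M)) (hM : Module.Projective R M)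
    (hD : Module.Projective R D) : Module.Projective R N := by
  obtain ⟨f, hf, -⟩ := exists_extension hNM hss (D.submoduleOf N).mkQ
    fun x hx => (Submodule.Quotient.mk_eq_zero _).2 hx
  -- Here f extends N → N/D to M, and l : M → N lifts f. Then id - l maps N into D, which exhibits N
  -- as a direct summand of M × D.
  obtain ⟨l, hl⟩ := Module.projective_lifting_property (D.submoduleOf N).mkQ f
    (Submodule.mkQ_surjective _)
  have hmem : ∀ x : N, ((LinearMap.id - l ∘ₗ Submodule.inclusion hNM : N →ₗ[R] N) x : V) ∈ D := by
    intro x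
    have h1 : (D.submoduleOf N).mkQ (l (Submodule.inclusion hNM x)) = (D.submoduleOf N).mkQ x :=
      (LinearMap.congr_fun hl _).trans (hf x)
    exact (Submodule.Quotient.eq (D.submoduleOf N)).1 h1.symm
  refine Module.Projective.of_split (M := M × D)
    (LinearMap.prod (Submodule.inclusion hNM)
      (LinearMap.codRestrict D (N.subtype ∘ₗ (LinearMap.id - l ∘ₗ Submodule.inclusion hNM)) hmem))
    (LinearMap.coprod l (Submodule.inclusion hDN)) ?_
  ext x
  change (l (Submodule.inclusion hNM x) : V) + (x - l (Submodule.inclusion hNM x)) = x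
  abel

/-- A two-sided ideal such that multiplication by it behaves on lattices as an invertible
operation, with semisimple quotients. -/
structure IsTwisting (a : Ideal R) : Prop where
  semisimple : ∀ (M : Type u) [AddCommGroup M] [Module R M],
    (∀ r ∈ a, ∀ x : M, r • x = 0) → IsSemisimpleModule R M
  projective : ∀ (n : ℕ) (M : Submodule R (Fin n → R)), Module.Projective R M →
    Module.Projective R (a • M : Submodule R (Fin n → R))
  covBy : ∀ (n : ℕ) (N M : Submodule R (Fin n → R)), N ⋖ M → a • N ⋖ a • M
  equiv : ∀ (n : ℕ) (N M : Submodule R (Fin n → R)), N ⋖ M → a • M ≤ N →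
    Nonempty ((M ⧸ N.submoduleOf M) ≃ₗ[R]
      ((a • M : Submodule R (Fin n → R)) ⧸ (a • N).submoduleOf (a • M)))

namespace IsTwisting

variable {a : Ideal R} (ha : IsTwisting a)
include ha

theorem semisimple_quotient {n : ℕ} (M : Submodule R (Fin n → R)) :
    IsSemisimpleModule R (M ⧸ (a • M).submoduleOf M) := by
  refine ha.semisimple _ fun r hr x => ?_
  obtain ⟨x, rfl⟩ := Submodule.mkQ_surjective _ x
  rw [← map_smul]
  exact (Submodule.Quotient.mk_eq_zero _).2 (Submodule.smul_mem_smul hr x.2)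

theorem projective_of_covBy {n : ℕ} {N M : Submodule R (Fin n → R)} (hNM : N ⋖ M)
    (haM : a • M ≤ N) (hM : Module.Projective R M) : Module.Projective R N :=
  projective_of_semisimple_quotient hNM.le haM (ha.semisimple_quotient M) hM
    (ha.projective n M hM)

/-- Every map to K kills multiples by a, so only the quotients M/aM and N/aN matter, and these have
matching factors. -/
theorem card_hom_eq_of_covBy {n : ℕ} {N M : Submodule R (Fin n → R)} (hNM : N ⋖ M)
    (haK : ∀ r ∈ a, ∀ x : K, r • x = 0) :
    Nat.card (M →ₗ[R] K) = Nat.card (N →ₗ[R] K) := by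
  have hkill : ∀ (L : Submodule R (Fin n → R)) (f : L →ₗ[R] K) (x : L), (x : Fin n → R) ∈ a • L →
      f x = 0 := by
    intro L f x hx
    rw [← Submodule.mem_smul_top_iff] at hx
    refine Submodule.smul_induction_on hx (fun r hr y _ => ?_) (fun y z hy hz => ?_)
    · rw [map_smul, haK r hr]
    · rw [map_add, hy, hz, add_zero]
  have hcov := ha.covBy n N M hNM
  by_cases haM : a • M ≤ N
  -- Along aN ≤ aM ≤ N ≤ M, the module M contributes M/N and N/aM, while N contributes N/aM and
  -- aM/aN; the outer factors are isomorphic.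
  · rw [card_hom_eq_mul hNM.le (ha.semisimple_quotient M) (hkill M),
      card_hom_eq_mul haM (ha.semisimple_quotient N) (hkill N), mul_comm]
    obtain ⟨e⟩ := ha.equiv n N M hNM haM
    congr 1
    exact Nat.card_congr ⟨fun f => f ∘ₗ e.symm.toLinearMap, fun f => f ∘ₗ e.toLinearMap,
      fun f => by ext; simp, fun f => by ext; simp⟩
  -- By the two covering relations N + aM = M and N ∩ aM = aN, so N/aN ≅ M/aM and restriction is
  -- bijective.
  · have hsup : N ⊔ a • M = M := by
      refine (hNM.eq_or_eq le_sup_left (sup_le hNM.le Submodule.smul_le_right)).resolve_left ?_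
      intro h
      exact haM (h ▸ le_sup_right)
    have hinf : N ⊓ a • M = a • N := by
      refine (hcov.eq_or_eq (le_inf Submodule.smul_le_right hcov.le) inf_le_right).resolve_right ?_
      intro h
      exact haM (h ▸ inf_le_left)
    refine Nat.card_congr (Equiv.ofBijective
      (fun f => f ∘ₗ Submodule.inclusion hNM.le) ⟨fun f f' hff => ?_, fun g => ?_⟩)
    · ext ⟨x, hx⟩
      have hx' := hx
      rw [← hsup, Submodule.mem_sup] at hx'
      obtain ⟨y, hy, z, hz, rfl⟩ := hx'
      have hzM : z ∈ M := Submodule.smul_le_right hz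
      have h1 : ∀ f : M →ₗ[R] K, f ⟨y + z, hx⟩ = f (Submodule.inclusion hNM.le ⟨y, hy⟩) :=
        fun f => by
          have : (⟨y + z, hx⟩ : M) = Submodule.inclusion hNM.le ⟨y, hy⟩ + ⟨z, hzM⟩ := rfl
          rw [this, map_add, hkill M f ⟨z, hzM⟩ hz, add_zero]
      rw [h1, h1]
      exact LinearMap.congr_fun hff _
    · obtain ⟨f, hf, -⟩ := exists_extension hNM.le (ha.semisimple_quotient M) g fun x hx =>
        hkill N g x (hinf ▸ ⟨x.2, hx⟩)
      exact ⟨f, LinearMap.ext hf⟩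

end IsTwisting

/-- A submodule of finite index which is not everything is covered by a submodule of smaller
index. -/
theorem exists_covBy_of_finite_quotient (N : Submodule R V) [Finite (V ⧸ N)] (hN : N ≠ ⊤) :
    ∃ M, N ⋖ M ∧ Finite (V ⧸ M) ∧ Nat.card (V ⧸ M) < Nat.card (V ⧸ N) := by
  have : Finite (Submodule R (V ⧸ N)) := Finite.of_injective _ SetLike.coe_injective
  have : Nontrivial (V ⧸ N) := Submodule.Quotient.nontrivial_iff.2 hN
  obtain ⟨a, ha⟩ := IsAtomic.exists_atom (Submodule R (V ⧸ N))
  have hcov : N ⋖ a.comap N.mkQ := by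
    rw [covBy_iff_lt_and_eq_or_eq]
    have hmap : ∀ c, N ≤ c → (c.map N.mkQ).comap N.mkQ = c := fun c hc => by
      rw [Submodule.comap_map_mkQ, sup_eq_right.2 hc]
    refine ⟨lt_of_le_of_ne (Submodule.le_comap_mkQ N a) fun h => ha.1 ?_, fun c hc hca => ?_⟩
    · rw [← Submodule.map_comap_eq_of_surjective N.mkQ_surjective a, ← h, Submodule.mkQ_map_self]
    · rcases ha.le_iff.1 (Submodule.map_le_iff_le_comap.2 hca) with h | h
      · left
        rw [← hmap c hc, h, Submodule.comap_bot, Submodule.ker_mkQ]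
      · right
        rw [← hmap c hc, h]
  have hlt : N.toAddSubgroup < (a.comap N.mkQ).toAddSubgroup := hcov.lt
  have hN' : Finite (V ⧸ N.toAddSubgroup) := ‹Finite (V ⧸ N)›
  have : N.toAddSubgroup.FiniteIndex := AddSubgroup.finiteIndex_of_finite_quotient
  refine ⟨_, hcov, ?_, AddSubgroup.index_strictAnti hlt⟩
  exact Finite.of_surjective _ (Submodule.factor_surjective hcov.le)

/-- Hom(N, -) is exact for projective N, so both sides are multiplicative along a simple submodule S
≤ K and its quotient. -/
theorem card_hom_eq_pow_of_projective (N : Type v) [AddCommGroup N] [Module R N]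
    [Module.Projective R N] (n : ℕ)
    (hN : ∀ (K : Type) [AddCommGroup K] [Module R K] [Finite K], IsSimpleModule R K →
      Nat.card (N →ₗ[R] K) = Nat.card K ^ n)
    (K : Type) [AddCommGroup K] [Module R K] [Finite K] :
    Nat.card (N →ₗ[R] K) = Nat.card K ^ n := by
  induction hd : Nat.card K using Nat.strong_induction_on generalizing K with
  | _ d ih =>
    subst hd
    rcases subsingleton_or_nontrivial K with h | h
    · simp
    · have : Finite (Submodule R K) := Finite.of_injective _ SetLike.coe_injective
      obtain ⟨S, hS⟩ := IsAtomic.exists_atom (Submodule R K)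
      have : Finite (K ⧸ S) := Finite.of_surjective _ S.mkQ_surjective
      have hcard : Nat.card K = Nat.card S * Nat.card (K ⧸ S) := 
        S.card_eq_card_quotient_mul_card
      have hS' := isSimpleModule_iff_isAtom.2 hS
      have : Nontrivial S := hS'.nontrivial
      have hlt : Nat.card (K ⧸ S) < Nat.card K := by
        rw [hcard]
        exact lt_mul_of_one_lt_left Nat.card_pos Finite.one_lt_card
      let ρ : (N →ₗ[R] K) →+ (N →ₗ[R] (K ⧸ S)) :=
        { toFun := fun f => S.mkQ ∘ₗ f
          map_zero' := LinearMap.comp_zero _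
          map_add' := fun _ _ => LinearMap.comp_add _ _ _ }
      have hρ : ρ.range = ⊤ := by
        rw [AddMonoidHom.range_eq_top]
        intro g
        exact Module.projective_lifting_property S.mkQ g S.mkQ_surjective
      have e : ρ.ker ≃ (N →ₗ[R] S) :=
        { toFun := fun f => LinearMap.codRestrict S f.1 fun x => by
            have := LinearMap.congr_fun (AddMonoidHom.mem_ker.1 f.2) x
            exact (Submodule.Quotient.mk_eq_zero _).1 this
          invFun := fun f => ⟨S.subtype ∘ₗ f, by
            rw [AddMonoidHom.mem_ker]
            ext x
            exact (Submodule.Quotient.mk_eq_zero _).2 (f x).2⟩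
          left_inv := fun f => by ext; rfl
          right_inv := fun f => by ext; rfl }
      rw [natCard_eq_card_ker_mul_card_range ρ, hρ, Nat.card_congr e, hN S hS',
        AddSubgroup.card_top, ih _ hlt (K ⧸ S) rfl, ← mul_pow, hcard]

/-- Induction on the index of N, through a submodule M covering N. Two different ideals serve: one
killing M/N carries projectivity from M to N, and one killing K compares the numbers of
homomorphisms. -/
theorem eulerOne_of_isTwisting
    (h : ∀ (K : Type) [AddCommGroup K] [Module R K] [Finite K], IsSimpleModule R K →
      ∃ a : Ideal R, IsTwisting a ∧ ∀ r ∈ a, ∀ x : K, r • x = 0) : EulerOne R := by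
  intro n N hN
  suffices Module.Projective R N ∧ ∀ (K : Type) [AddCommGroup K] [Module R K] [Finite K],
      IsSimpleModule R K → Nat.card (N →ₗ[R] K) = Nat.card K ^ n by
    obtain ⟨h1, h2⟩ := this
    intro K _ _ _
    exact card_hom_eq_pow_of_projective N n h2 K
  induction hd : Nat.card ((Fin n → R) ⧸ N) using Nat.strong_induction_on generalizing N with
  | _ d ih =>
    subst hd
    by_cases htop : N = ⊤
    · subst htop
      refine ⟨.of_equiv (Submodule.topEquiv (R := R) (M := Fin n → R)).symm, fun K _ _ _ _ => ?_⟩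
      rw [← Nat.card_congr (LinearEquiv.congrLeft K ℕ
        (Submodule.topEquiv (R := R) (M := Fin n → R)).symm).toEquiv,
        ← Nat.card_congr ((Pi.basisFun R (Fin n)).constr ℕ).toEquiv, Nat.card_pi]
      simp
    · obtain ⟨M, hNM, hfin, hlt⟩ := exists_covBy_of_finite_quotient N htop
      obtain ⟨hM1, hM2⟩ := ih _ hlt M hfin rfl
      refine ⟨?_, fun K _ _ _ hK => ?_⟩
      · have hs : IsSimpleModule R (M ⧸ N.submoduleOf M) :=
          (covBy_iff_quot_is_simple hNM.le).1 hNM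
        have hT : Finite (M ⧸ N.submoduleOf M) := by
          refine Finite.of_injective (Submodule.mapQ (N.submoduleOf M) N M.subtype le_rfl) ?_
          exact LinearMap.ker_eq_bot.1 (Submodule.ker_liftQ_eq_bot _ _ _ (by
            rw [LinearMap.ker_comp, Submodule.ker_mkQ]; rfl))
        let e := Shrink.linearEquiv.{0} R (M ⧸ N.submoduleOf M)
        have : Finite (Shrink.{0} (M ⧸ N.submoduleOf M)) := Finite.of_equiv _ e.symm.toEquiv
        obtain ⟨a, ha, haK⟩ := h (Shrink.{0} (M ⧸ N.submoduleOf M)) (.congr e)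
        refine ha.projective_of_covBy hNM (Submodule.smul_le.2 fun r hr x hx => ?_) hM1
        have h1 := haK r hr (e.symm ((N.submoduleOf M).mkQ ⟨x, hx⟩))
        rw [← map_smul, LinearEquiv.map_eq_zero_iff, ← map_smul] at h1
        exact (Submodule.Quotient.mk_eq_zero (N.submoduleOf M)).1 h1
      · obtain ⟨a, ha, haK⟩ := h K hK
        rw [← ha.card_hom_eq_of_covBy hNM haK, hM2 K hK]

end Lattices
end CLM

namespace CLM

/-! ### Group rings over `ℤ[|Γ|⁻¹]` -/

section TorsionFree

universe u

variable {R : Type u} [Ring R]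

/-- Multiplication by an integer, as a linear map. -/
def natMul (p : ℕ) (M : Type*) [AddCommGroup M] [Module R M] : M →ₗ[R] M :=
  p • LinearMap.id

theorem natMul_apply (p : ℕ) {M : Type*} [AddCommGroup M] [Module R M] (x : M) :
    natMul (R := R) p M x = p • x := rfl

theorem span_natCast_smul (p : ℕ) {V : Type*} [AddCommGroup V] [Module R V] (M : Submodule R V) :
    Ideal.span {(p : R)} • M = M.map (natMul p V) := by
  apply le_antisymm
  · refine Submodule.smul_le.2 fun r hr x hx => ?_
    obtain ⟨s, rfl⟩ := Submodule.mem_span_singleton.1 hr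
    exact ⟨s • x, M.smul_mem s hx, by
      rw [natMul_apply, smul_eq_mul, mul_smul, Nat.cast_smul_eq_nsmul, smul_comm]⟩
  · rintro _ ⟨x, hx, rfl⟩
    rw [natMul_apply, ← Nat.cast_smul_eq_nsmul R]
    exact Submodule.smul_mem_smul (Submodule.mem_span_singleton_self _) hx

/-- Multiplication by p is an injective endomorphism of R^n carrying M isomorphically onto pM, so
projectivity, covering pairs and quotients are all transported. -/
theorem isTwisting_span_natCast (p : ℕ) (htf : ∀ x : R, p • x = 0 → x = 0)
    (hss : ∀ (M : Type u) [AddCommGroup M] [Module R M], (∀ x : M, p • x = 0) →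
      IsSemisimpleModule R M) : IsTwisting (Ideal.span {(p : R)}) := by
  have hinj : ∀ n, Function.Injective (natMul (R := R) p (Fin n → R)) := fun n => by
    rw [← LinearMap.ker_eq_bot, LinearMap.ker_eq_bot']
    intro x hx
    ext i
    exact htf _ (congrFun hx i)
  refine ⟨fun M _ _ h => hss M fun x => ?_, fun n M hM => ?_, fun n N M hNM => ?_,
    fun n N M hNM _ => ?_⟩
  · rw [← Nat.cast_smul_eq_nsmul R]
    exact h _ (Submodule.mem_span_singleton_self _) x
  · rw [span_natCast_smul]
    exact .of_equiv (M.equivMapOfInjective _ (hinj n))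
  · rw [span_natCast_smul, span_natCast_smul, covBy_iff_lt_and_eq_or_eq]
    refine ⟨(Submodule.map_strictMono_of_injective (hinj n)) hNM.lt, fun c hNc hcM => ?_⟩
    have hc : (c.comap (natMul p _)).map (natMul p _) = c :=
      Submodule.map_comap_eq_self (hcM.trans (LinearMap.map_le_range))
    rw [← hc] at hNc hcM ⊢
    rw [Submodule.map_le_map_iff_of_injective (hinj n)] at hNc hcM
    exact (hNM.eq_or_eq hNc hcM).imp (congrArg _) (congrArg _)
  · rw [span_natCast_smul, span_natCast_smul]
    refine ⟨Submodule.Quotient.equiv _ _ (M.equivMapOfInjective _ (hinj n)) ?_⟩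
    ext ⟨x, hx⟩
    constructor
    · rintro ⟨y, hy, hyx⟩
      exact ⟨y, hy, congrArg Subtype.val hyx⟩
    · rintro ⟨y, hy, hyx⟩
      exact ⟨⟨y, hNM.le hy⟩, hy, Subtype.ext hyx⟩

/-- A finite simple module is killed by a prime number. -/
theorem exists_prime_smul_eq_zero (K : Type*) [AddCommGroup K] [Module R K] [Finite K]
    [IsSimpleModule R K] : ∃ p : ℕ, p.Prime ∧ ∀ x : K, p • x = 0 := by
  have := Fintype.ofFinite K
  have := IsSimpleModule.nontrivial R K
  obtain ⟨p, hp, hpK⟩ := Nat.exists_prime_and_dvd (Fintype.one_lt_card (α := K)).ne'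
  have := Fact.mk hp
  obtain ⟨x, hx⟩ := exists_prime_addOrderOf_dvd_card p hpK
  refine ⟨p, hp, fun y => ?_⟩
  -- Schur's lemma: multiplication by p kills the element x of order p, hence is zero.
  rcases (natMul (R := R) p K).bijective_or_eq_zero with h | h
  · have h0 : natMul (R := R) p K x = 0 := by rw [natMul_apply, ← hx, addOrderOf_nsmul_eq_zero]
    rw [(LinearMap.map_eq_zero_iff _ h.1).1 h0, addOrderOf_zero] at hx
    exact absurd hx.symm hp.one_lt.ne'
  · exact LinearMap.congr_fun h y

end TorsionFree

/-! ### Maschke's theorem and the Euler property of the group ring -/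

section GroupRing

theorem isUnit_card_away (Γ : Type*) : IsUnit (Nat.card Γ : Localization.Away (Nat.card Γ : ℤ)) := by
  have := IsLocalization.Away.algebraMap_isUnit (S := Localization.Away (Nat.card Γ : ℤ))
    (Nat.card Γ : ℤ)
  simpa using this

variable {Γ : Type*} [Group Γ] [Finite Γ]

theorem exists_projection {F : Type*} [Field F] {M : Type*} [AddCommGroup M] [Module F M]
    (W : Submodule F M) : ∃ π : M →+ M, (∀ x, π x ∈ W) ∧ ∀ w ∈ W, π w = w := by
  obtain ⟨C, hC⟩ := Submodule.exists_isCompl W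
  exact ⟨(W.projection C hC).toAddMonoidHom, W.projection_apply_mem hC,
    fun w hw => Submodule.projection_apply_left hC ⟨w, hw⟩⟩

theorem exists_projection_of_prime_smul_eq_zero {p : ℕ} (hp : p.Prime) {M : Type*}
    [AddCommGroup M] (hM : ∀ x : M, p • x = 0) (W : AddSubgroup M) :
    ∃ π : M →+ M, (∀ x, π x ∈ W) ∧ ∀ w ∈ W, π w = w := by
  have := Fact.mk hp
  have inst : Module (ZMod p) M := AddCommGroup.zmodModule hM
  exact exists_projection (AddSubgroup.toZModSubmodule p W)

/-- Averaging a projection over a group whose order is invertible. -/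
theorem exists_isCompl_of_projection {k : Type*} [CommRing k] (hk : IsUnit (Nat.card Γ : k))
    {M : Type*} [AddCommGroup M] [Module k M] [Module (MonoidAlgebra k Γ) M]
    [IsScalarTower k (MonoidAlgebra k Γ) M] (W : Submodule (MonoidAlgebra k Γ) M)
    (π : M →ₗ[k] M) (hW : ∀ x, π x ∈ W) (hπ : ∀ w ∈ W, π w = w) : ∃ C, IsCompl W C := by
  have := Fintype.ofFinite Γ
  let π' : M →ₗ[k] W := LinearMap.codRestrict (W.restrictScalars k) π hW
  exact ⟨_, LinearMap.isCompl_of_proj (f := π'.equivariantProjection Γ)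
    (LinearMap.equivariantProjection_condition Γ π' W.subtype hk
      fun w => Subtype.ext (hπ w w.2))⟩

/-- Additive maps between modules over a localization of `ℤ` are linear. -/
theorem exists_linearMap_of_addMonoidHom (S : Submonoid ℤ) (A : Type*) [CommRing A] [Algebra ℤ A]
    [IsLocalization S A] {M : Type*} [AddCommGroup M] [Module A M]
    (f : M →+ M) : ∃ g : M →ₗ[A] M, ∀ x, g x = f x := by
  -- Identifies the given ℤ-algebra structure with the canonical one, with respect to which additive
  -- maps are ℤ-linear.
  obtain rfl : ‹Algebra ℤ A› = Ring.toIntAlgebra A := Subsingleton.elim _ _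
  exact ⟨LinearMap.extendScalarsOfIsLocalization S A f.toIntLinearMap, fun x => rfl⟩

/-- Maschke's theorem for modules of prime exponent over `ℤ[|Γ|⁻¹, Γ]`. -/
theorem isSemisimpleModule_of_prime_smul_eq_zero {p : ℕ} (hp : p.Prime) (M : Type*)
    [AddCommGroup M] [Module (AwayGroupRing Γ) M] (hM : ∀ x : M, p • x = 0) :
    IsSemisimpleModule (AwayGroupRing Γ) M := by
  refine { exists_isCompl := fun W => ?_ }
  obtain ⟨π₀, hW, hπ₀⟩ := exists_projection_of_prime_smul_eq_zero hp hM
    (Submodule.toAddSubgroup (R := AwayGroupRing Γ) W)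
  let inst : Module (Localization.Away (Nat.card Γ : ℤ)) M :=
    Module.compHom M (algebraMap (Localization.Away (Nat.card Γ : ℤ)) (AwayGroupRing Γ))
  have : IsScalarTower (Localization.Away (Nat.card Γ : ℤ)) (AwayGroupRing Γ) M :=
    ⟨fun r s x => by rw [Algebra.smul_def, mul_smul]; rfl⟩
  obtain ⟨π, hπ⟩ := exists_linearMap_of_addMonoidHom (.powers (Nat.card Γ : ℤ))
    (Localization.Away (Nat.card Γ : ℤ)) π₀
  exact exists_isCompl_of_projection (isUnit_card_away Γ) W π
    (fun x => by rw [hπ]; exact hW x) fun w hw => (hπ w).trans (hπ₀ w hw)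

theorem eulerOne_awayGroupRing : EulerOne (AwayGroupRing Γ) := by
  refine eulerOne_of_isTwisting fun K _ _ _ hK => ?_
  obtain ⟨p, hp, hpK⟩ := exists_prime_smul_eq_zero (R := AwayGroupRing Γ) K
  refine ⟨Ideal.span {(p : AwayGroupRing Γ)}, isTwisting_span_natCast p (fun x hx => ?_)
    (fun M _ _ h => isSemisimpleModule_of_prime_smul_eq_zero hp M h), fun r hr x => ?_⟩
  -- Inverting the nonzero integer |Γ| leaves a domain of characteristic zero, so p-torsion can be
  -- excluded coefficientwise.
  · have hle : Submonoid.powers (Nat.card Γ : ℤ) ≤ nonZeroDivisors ℤ :=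
      powers_le_nonZeroDivisors_of_noZeroDivisors (Nat.cast_ne_zero.2 Nat.card_pos.ne')
    have : IsDomain (Localization.Away (Nat.card Γ : ℤ)) := IsLocalization.isDomain_localization hle
    have : CharZero (Localization.Away (Nat.card Γ : ℤ)) :=
      charZero_of_injective_algebraMap (IsLocalization.injective _ hle)
    ext g
    have h1 := DFunLike.congr_fun (congrArg MonoidAlgebra.coeff hx) g
    have h2 : p • x.coeff g = 0 := h1
    exact (smul_eq_zero.1 h2).resolve_left hp.ne_zero
  · obtain ⟨s, rfl⟩ := Submodule.mem_span_singleton.1 hr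
    rw [smul_eq_mul, mul_smul, Nat.cast_smul_eq_nsmul, hpK, smul_zero]

end GroupRing
end CLM

namespace CLM

/-! ### Modules killed by the annihilator of a finite simple module -/

section Primitive

universe u v w

variable {R : Type u} [Ring R] {K : Type v} [AddCommGroup K] [Module R K]

/-- `R` acts on `K`; the image of `R` in `K → K`. -/
def actionMap (R : Type u) [Ring R] (K : Type v) [AddCommGroup K] [Module R K] :
    R →ₗ[R] (K → K) :=
  LinearMap.pi fun k => LinearMap.toSpanSingleton R K k

theorem ker_actionMap : LinearMap.ker (actionMap R K) = Module.annihilator R K := by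
  ext r
  rw [LinearMap.mem_ker, Module.mem_annihilator]
  exact ⟨fun h k => congrFun h k, fun h => funext h⟩

variable {M : Type w} [AddCommGroup M] [Module R M]

/-- R/Ann(K) embeds in the power K^K by r ↦ (r k)_k. If Ann(K) kills M, each cyclic submodule R x is
a quotient of this image. -/
theorem exists_range_actionMap_map (hM : Module.annihilator R K ≤ Module.annihilator R M) (x : M) :
    ∃ f : LinearMap.range (actionMap R K) →ₗ[R] M, ∀ r, f ⟨actionMap R K r, r, rfl⟩ = r • x := by
  refine ⟨(LinearMap.ker (actionMap R K)).liftQ (LinearMap.toSpanSingleton R M x) ?_ ∘ₗ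
    (actionMap R K).quotKerEquivRange.symm.toLinearMap, fun r => ?_⟩
  · rw [ker_actionMap]
    exact fun r hr => Module.mem_annihilator.1 (hM hr) x
  · have : (actionMap R K).quotKerEquivRange.symm ⟨actionMap R K r, r, rfl⟩ =
        Submodule.Quotient.mk r := by
      rw [LinearEquiv.symm_apply_eq]
      rfl
    rw [LinearMap.comp_apply, LinearEquiv.coe_coe, this]
    rfl

variable [Finite K] [IsSimpleModule R K]

/-- M is the sum of its cyclic submodules, which are quotients of a submodule of the semisimple
module K^K; finiteness of K makes this a finite power. -/
theorem isSemisimpleModule_of_annihilator_le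
    (hM : Module.annihilator R K ≤ Module.annihilator R M) : IsSemisimpleModule R M := by
  refine isSemisimpleModule_of_isSemisimpleModule_submodule'
    (p := fun x : M => Submodule.span R {x}) (fun x => ?_) ?_
  · obtain ⟨f, hf⟩ := exists_range_actionMap_map hM x
    have hfx : ∀ y, f y ∈ Submodule.span R {x} := by
      rintro ⟨_, r, rfl⟩
      rw [hf]
      exact Submodule.smul_mem _ _ (Submodule.mem_span_singleton_self x)
    refine .of_surjective (LinearMap.codRestrict _ f hfx) ?_
    rintro ⟨y, hy⟩
    obtain ⟨r, rfl⟩ := Submodule.mem_span_singleton.1 hy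
    exact ⟨⟨actionMap R K r, r, rfl⟩, Subtype.ext (hf r)⟩
  · rw [eq_top_iff]
    exact fun x _ => Submodule.mem_iSup_of_mem x (Submodule.mem_span_singleton_self x)

/-- By semisimplicity the simple quotient M of R/Ann(K) also embeds in K^K; some coordinate
projection is then nonzero on it, and Schur's lemma applies. -/
theorem nonempty_linearEquiv_of_annihilator_le [IsSimpleModule R M]
    (hM : Module.annihilator R K ≤ Module.annihilator R M) : Nonempty (M ≃ₗ[R] K) := by
  have := IsSimpleModule.nontrivial R M
  obtain ⟨x, hx⟩ := exists_ne (0 : M)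
  obtain ⟨f, hf⟩ := exists_range_actionMap_map hM x
  have hf0 : f ≠ 0 := fun h => hx <| by
    have := hf 1
    rwa [h, one_smul, LinearMap.zero_apply, eq_comm] at this
  obtain ⟨S, ⟨e⟩⟩ := LinearMap.linearEquiv_of_ne_zero hf0
  have he : (e x : LinearMap.range (actionMap R K)) ≠ 0 := by
    simpa using hx
  have he' : ((e x : LinearMap.range (actionMap R K)) : K → K) ≠ 0 := by
    simpa using hx
  obtain ⟨k, hk⟩ := Function.ne_iff.1 he'
  let g : M →ₗ[R] K := LinearMap.proj k ∘ₗ (LinearMap.range (actionMap R K)).subtype ∘ₗ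
    S.subtype ∘ₗ e.toLinearMap
  have hg : g ≠ 0 := fun h => hk (LinearMap.congr_fun h x)
  exact ⟨.ofBijective g (g.bijective_or_eq_zero.resolve_right hg)⟩

theorem annihilator_eq_of_le [IsSimpleModule R M]
    (hM : Module.annihilator R K ≤ Module.annihilator R M) :
    Module.annihilator R K = Module.annihilator R M := by
  obtain ⟨e⟩ := nonempty_linearEquiv_of_annihilator_le hM
  exact e.symm.annihilator_eq

end Primitive

/-! ### Invertible ideals -/

section Invertible

universe u v

variable {R : Type u} [Ring R] {A : Type v} [Ring A] (j : R →+* A)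

/-- The elements of `A` multiplying the ideal `Q` into `R` from both sides. -/
def idealInv (Q : Ideal R) : Set A :=
  {y | (∀ q ∈ Q, ∃ r, j r = j q * y) ∧ ∀ q ∈ Q, ∃ r, j r = y * j q}

/-- A two-sided ideal `Q` of `R` is invertible in `A`. -/
structure IsInvertibleIdeal (Q : Ideal R) : Prop where
  right : (1 : A) ∈ AddSubmonoid.closure {z | ∃ q ∈ Q, ∃ y ∈ idealInv j Q, z = j q * y}
  left : (1 : A) ∈ AddSubmonoid.closure {z | ∃ q ∈ Q, ∃ y ∈ idealInv j Q, z = y * j q}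

variable {j} {Q : Ideal R}

theorem exists_inv_smul {n : ℕ} {y : A} (hy : y ∈ idealInv j Q) {M : Submodule R (Fin n → R)}
    {x : Fin n → R} (hx : x ∈ Q • M) :
    ∃ m ∈ M, ∀ i, j (m i) = y * j (x i) := by
  refine Submodule.smul_induction_on hx (fun q hq m hm => ?_) ?_
  · obtain ⟨r, hr⟩ := hy.2 q hq
    exact ⟨r • m, M.smul_mem r hm, fun i => by
      rw [Pi.smul_apply, Pi.smul_apply, smul_eq_mul, smul_eq_mul, map_mul, map_mul, hr, mul_assoc]⟩
  · rintro a b ⟨m, hm, h⟩ ⟨m', hm', h'⟩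
    exact ⟨m + m', M.add_mem hm hm', fun i => by
      rw [Pi.add_apply, Pi.add_apply, map_add, map_add, h, h', mul_add]⟩

variable (hj : Function.Injective j)
include hj

/-- Cancellation of Q: writing 1 = ∑ y q gives m = ∑ y (q m), and y sends Q N into N. -/
theorem le_of_smul_le_smul_of_isInvertibleIdeal (hQ : IsInvertibleIdeal j Q) {n : ℕ}
    {N M : Submodule R (Fin n → R)} (h : Q • M ≤ Q • N) : M ≤ N := by
  intro m hm
  have key : ∀ z ∈ AddSubmonoid.closure {z | ∃ q ∈ Q, ∃ y ∈ idealInv j Q, z = y * j q},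
      ∃ w ∈ N, ∀ i, j (w i) = z * j (m i) := by
    intro z hz
    induction hz using AddSubmonoid.closure_induction with
    | mem z hz =>
      obtain ⟨q, hq, y, hy, rfl⟩ := hz
      obtain ⟨w, hw, hwi⟩ := exists_inv_smul hy (h (Submodule.smul_mem_smul hq hm))
      exact ⟨w, hw, fun i => by rw [hwi, Pi.smul_apply, smul_eq_mul, map_mul, mul_assoc]⟩
    | zero => exact ⟨0, N.zero_mem, fun i => by simp⟩
    | add a b _ _ ha hb =>
      obtain ⟨w, hw, h⟩ := ha
      obtain ⟨w', hw', h'⟩ := hb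
      exact ⟨w + w', N.add_mem hw hw', fun i => by
        rw [Pi.add_apply, map_add, h, h', add_mul]⟩
  obtain ⟨w, hw, hwi⟩ := key 1 hQ.left
  have : w = m := funext fun i => hj (by rw [hwi, one_mul])
  exact this ▸ hw

/-- The submodule c' = {x ∈ M : Q x ⊆ c} plays the role of Q⁻¹c, and writing 1 = ∑ q y gives c ⊆ Q
c'. -/
theorem exists_smul_eq_of_isInvertibleIdeal (hQ : IsInvertibleIdeal j Q) [Q.IsTwoSided] {n : ℕ}
    {N M c : Submodule R (Fin n → R)} (hNM : N ≤ M) (hNc : Q • N ≤ c) (hcM : c ≤ Q • M) :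
    ∃ c', N ≤ c' ∧ c' ≤ M ∧ Q • c' = c := by
  let c' : Submodule R (Fin n → R) :=
    { carrier := {x | x ∈ M ∧ ∀ q ∈ Q, q • x ∈ c}
      add_mem' := fun {a b} ha hb => ⟨M.add_mem ha.1 hb.1, fun q hq => by
        rw [smul_add]; exact c.add_mem (ha.2 q hq) (hb.2 q hq)⟩
      zero_mem' := ⟨M.zero_mem, fun q _ => by rw [smul_zero]; exact c.zero_mem⟩
      smul_mem' := fun r a ha => ⟨M.smul_mem r ha.1, fun q hq => by
        rw [smul_smul]; exact ha.2 _ (Q.mul_mem_right r hq)⟩ }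
  refine ⟨c', fun x hx => ⟨hNM hx, fun q hq => hNc (Submodule.smul_mem_smul hq hx)⟩,
    fun x hx => hx.1, le_antisymm (Submodule.smul_le.2 fun q hq x hx => hx.2 q hq) fun x hx => ?_⟩
  have key : ∀ z ∈ AddSubmonoid.closure {z | ∃ q ∈ Q, ∃ y ∈ idealInv j Q, z = j q * y},
      ∃ w ∈ Q • c', ∀ i, j (w i) = z * j (x i) := by
    intro z hz
    induction hz using AddSubmonoid.closure_induction with
    | mem z hz =>
      obtain ⟨q, hq, y, hy, rfl⟩ := hz
      obtain ⟨w, hw, hwi⟩ := exists_inv_smul hy (hcM hx)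
      refine ⟨q • w, Submodule.smul_mem_smul hq ⟨hw, fun q' hq' => ?_⟩, fun i => by
        rw [Pi.smul_apply, smul_eq_mul, map_mul, hwi, mul_assoc]⟩
      obtain ⟨r, hr⟩ := hy.1 q' hq'
      have : q' • w = r • x := funext fun i => hj (by
        rw [Pi.smul_apply, Pi.smul_apply, smul_eq_mul, smul_eq_mul, map_mul, map_mul, hwi, hr,
          mul_assoc])
      rw [this]
      exact c.smul_mem r hx
    | zero => exact ⟨0, Submodule.zero_mem _, fun i => by simp⟩
    | add a b _ _ ha hb =>
      obtain ⟨w, hw, h⟩ := ha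
      obtain ⟨w', hw', h'⟩ := hb
      exact ⟨w + w', Submodule.add_mem _ hw hw', fun i => by
        rw [Pi.add_apply, map_add, h, h', add_mul]⟩
  obtain ⟨w, hw, hwi⟩ := key 1 hQ.right
  have : w = x := funext fun i => hj (by rw [hwi, one_mul])
  exact this ▸ hw

theorem covBy_smul_of_isInvertibleIdeal (hQ : IsInvertibleIdeal j Q) [Q.IsTwoSided] {n : ℕ}
    {N M : Submodule R (Fin n → R)} (hNM : N ⋖ M) : Q • N ⋖ Q • M := by
  rw [covBy_iff_lt_and_eq_or_eq]
  refine ⟨lt_of_le_not_ge (Submodule.smul_mono le_rfl hNM.le) fun h =>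
    hNM.lt.not_ge (le_of_smul_le_smul_of_isInvertibleIdeal hj hQ h), fun c hNc hcM => ?_⟩
  obtain ⟨c', h1, h2, rfl⟩ := exists_smul_eq_of_isInvertibleIdeal hj hQ hNM.le hNc hcM
  exact (hNM.eq_or_eq h1 h2).imp (congrArg _) (congrArg _)

/-- Right multiplication by an element of the inverse of an ideal. -/
theorem exists_mulRight {y : A} (hy : y ∈ idealInv j Q) :
    ∃ f : Q →ₗ[R] R, ∀ q, j (f q) = j q * y := by
  choose f hf using fun q : Q => hy.1 q q.2
  refine ⟨{ toFun := f, map_add' := fun a b => hj ?_, map_smul' := fun r a => hj ?_ }, hf⟩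
  · rw [map_add, hf, hf, hf, Submodule.coe_add, map_add, add_mul]
  · rw [hf, Submodule.coe_smul, smul_eq_mul, map_mul, RingHom.id_apply, smul_eq_mul, map_mul, hf,
      mul_assoc]

/-- A dual basis argument. Split M off R^k with coordinates f_κ and generators p(e_κ), and write 1 =
∑ y_i q_i. On Q M the f_κ take values in Q, so f_κ(x) y_i lies in R and x = ∑ (f_κ(x) y_i) · q_i
p(e_κ). -/
theorem projective_smul_of_isInvertibleIdeal (hQ : IsInvertibleIdeal j Q) [Q.IsTwoSided]
    [IsNoetherianRing R] {n : ℕ}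
    (M : Submodule R (Fin n → R)) (hM : Module.Projective R M) :
    Module.Projective R (Q • M : Submodule R (Fin n → R)) := by
  obtain ⟨l, hl, hl1⟩ := AddSubmonoid.exists_list_of_mem_closure hQ.left
  choose q hq y hy hqy using fun i : Fin l.length => hl (l.get i) (l.get_mem i)
  obtain ⟨k, p, hp⟩ := Module.Finite.exists_fin' R M
  obtain ⟨f, hf⟩ := Module.projective_lifting_property p LinearMap.id hp
  choose ρ hρ using fun i => exists_mulRight hj (hy i)
  have hsum : ∀ a : Q, ∑ i, ρ i a * q i = a := fun a => hj <| by
    have h1 : ∑ i, y i * j (q i) = 1 := by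
      simp_rw [← hqy]
      rw [← hl1]
      simp [Fin.sum_univ_getElem]
    simp_rw [map_sum, map_mul, hρ, mul_assoc]
    rw [← Finset.mul_sum, h1, mul_one]
  have hle : Q • M ≤ M := Submodule.smul_le_right
  have hmem : ∀ (κ : Fin k) (x : (Q • M : Submodule R (Fin n → R))),
      (LinearMap.proj κ ∘ₗ f ∘ₗ Submodule.inclusion hle) x ∈ Q := by
    intro κ x
    have hx := (Submodule.mem_smul_top_iff Q M (Submodule.inclusion hle x)).2 x.2
    change f _ κ ∈ Q
    refine Submodule.smul_induction_on hx (fun r hr z _ => ?_) (fun a b ha hb => ?_)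
    · rw [map_smul]
      exact Q.mul_mem_right _ hr
    · rw [map_add]
      exact Q.add_mem ha hb
  let s : (Q • M : Submodule R (Fin n → R)) →ₗ[R] (Fin l.length × Fin k → R) :=
    LinearMap.pi fun a => ρ a.1 ∘ₗ LinearMap.codRestrict Q _ (hmem a.2)
  let t : (Fin l.length × Fin k → R) →ₗ[R] (Q • M : Submodule R (Fin n → R)) :=
    Fintype.linearCombination R fun a => ⟨q a.1 • (p (Pi.single a.2 1) : Fin n → R),
      Submodule.smul_mem_smul (hq a.1) (p _).2⟩
  refine Module.Projective.of_split s t ?_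
  refine LinearMap.ext fun x => Subtype.ext ?_
  have h2 : ∀ v : Fin k → R, p v = ∑ κ, v κ • p (Pi.single κ 1) := fun v => by
    conv_lhs => rw [← Finset.univ_sum_single v]
    rw [map_sum]
    refine Finset.sum_congr rfl fun κ _ => ?_
    rw [← map_smul, ← Pi.single_smul, smul_eq_mul, mul_one]
  have h3 : (t (s x) : Fin n → R) = ∑ a : Fin l.length × Fin k,
      (ρ a.1 ⟨_, hmem a.2 x⟩ * q a.1) • (p (Pi.single a.2 1) : Fin n → R) := by
    simp only [t, s, Fintype.linearCombination_apply, Submodule.coe_sum, Submodule.coe_smul,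
      smul_smul]
    rfl
  rw [LinearMap.comp_apply, h3, Fintype.sum_prod_type_right]
  have h4 := congrArg Subtype.val (LinearMap.congr_fun hf (Submodule.inclusion hle x))
  rw [LinearMap.comp_apply, h2, Submodule.coe_sum] at h4
  refine (Finset.sum_congr rfl fun κ _ => ?_).trans h4
  dsimp only
  rw [← Finset.sum_smul]
  exact congrArg (· • (p (Pi.single κ 1) : Fin n → R)) (hsum ⟨_, hmem κ x⟩)

end Invertible
end CLM

namespace CLM

/-! ### Invertibility of annihilators of simple modules -/

section Products

universe u

variable {R : Type u} [Ring R]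

/-- `P` is the annihilator of a finite simple module. -/
def IsSimpleAnnihilator (P : Ideal R) : Prop :=
  ∃ (K : Type) (_ : AddCommGroup K) (_ : Module R K), Finite K ∧ IsSimpleModule R K ∧
    P = Module.annihilator R K

/-- The ordered product of a list of ideals. -/
def idealProd (l : List (Ideal R)) : Ideal R := l.foldr (· * ·) ⊤

theorem idealProd_cons (P : Ideal R) (l : List (Ideal R)) :
    idealProd (P :: l) = P * idealProd l := rfl

theorem idealProd_append (l l' : List (Ideal R)) :
    idealProd (l ++ l') = idealProd l * idealProd l' := by
  induction l with
  | nil => exact (Submodule.top_smul _).symm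
  | cons P l ih =>
    rw [List.cons_append, idealProd_cons, idealProd_cons, ih]
    exact (Submodule.mul_smul _ _ _).symm

namespace IsSimpleAnnihilator

theorem isTwoSided {P : Ideal R} (hP : IsSimpleAnnihilator P) : P.IsTwoSided := by
  obtain ⟨K, _, _, -, -, rfl⟩ := hP
  infer_instance

theorem exists_natCast_mem {P : Ideal R} (hP : IsSimpleAnnihilator P) :
    ∃ m : ℕ, m ≠ 0 ∧ (m : R) ∈ P := by
  obtain ⟨K, _, _, _, -, rfl⟩ := hP
  refine ⟨Nat.card K, Nat.card_pos.ne', Module.mem_annihilator.2 fun x => ?_⟩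
  rw [Nat.cast_smul_eq_nsmul, card_nsmul_eq_zero']

theorem eq_of_le {P Q : Ideal R} (hP : IsSimpleAnnihilator P) (hQ : IsSimpleAnnihilator Q)
    (h : P ≤ Q) : P = Q := by
  obtain ⟨K, _, _, _, _, rfl⟩ := hP
  obtain ⟨L, _, _, _, _, rfl⟩ := hQ
  exact annihilator_eq_of_le h

/-- Primeness: J K is a submodule of the simple module K. If it is zero then J ≤ P; if it is K then
I K = I J K = 0. -/
theorem le_or_le_of_mul_le {P I J : Ideal R} (hP : IsSimpleAnnihilator P) (h : I * J ≤ P) :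
    I ≤ P ∨ J ≤ P := by
  obtain ⟨K, _, _, _, _, rfl⟩ := hP
  rcases eq_bot_or_eq_top (J • (⊤ : Submodule R K)) with hJ | hJ
  · right
    intro r hr
    rw [Module.mem_annihilator]
    intro x
    rw [← Submodule.mem_bot R, ← hJ]
    exact Submodule.smul_mem_smul hr trivial
  · left
    intro r hr
    rw [Module.mem_annihilator]
    intro x
    have hx : x ∈ J • (⊤ : Submodule R K) := by rw [hJ]; exact Submodule.mem_top
    refine Submodule.smul_induction_on hx (fun s hs y _ => ?_) (fun a b ha hb => ?_)
    · rw [smul_smul]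
      exact Module.mem_annihilator.1 (h (Ideal.mul_mem_mul hr hs)) y
    · rw [smul_add, ha, hb, add_zero]

theorem mem_of_idealProd_le {Q : Ideal R} (hQ : IsSimpleAnnihilator Q) {l : List (Ideal R)}
    (hl : ∀ P ∈ l, IsSimpleAnnihilator P) (h : idealProd l ≤ Q) : Q ∈ l := by
  induction l with
  | nil =>
    obtain ⟨K, _, _, _, _, rfl⟩ := hQ
    have := IsSimpleModule.nontrivial R K
    exact absurd (Module.annihilator_eq_top_iff.1 (top_le_iff.1 h)) (not_subsingleton K)
  | cons P l ih =>
    rw [List.forall_mem_cons] at hl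
    rcases hQ.le_or_le_of_mul_le h with h | h
    · rw [hl.1.eq_of_le hQ h]
      exact List.mem_cons_self
    · exact List.mem_cons_of_mem _ (ih hl.2 h)

end IsSimpleAnnihilator

theorem isTwoSided_idealProd {l : List (Ideal R)} (hl : ∀ P ∈ l, IsSimpleAnnihilator P) :
    (idealProd l).IsTwoSided := by
  induction l with
  | nil => exact inferInstanceAs (⊤ : Ideal R).IsTwoSided
  | cons P l ih =>
    rw [List.forall_mem_cons] at hl
    have := ih hl.2
    exact inferInstanceAs (P * idealProd l).IsTwoSided

theorem exists_natCast_mem_idealProd {l : List (Ideal R)}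
    (hl : ∀ P ∈ l, IsSimpleAnnihilator P) : ∃ m : ℕ, m ≠ 0 ∧ (m : R) ∈ idealProd l := by
  induction l with
  | nil => exact ⟨1, one_ne_zero, trivial⟩
  | cons P l ih =>
    rw [List.forall_mem_cons] at hl
    obtain ⟨m, hm, hmP⟩ := hl.1.exists_natCast_mem
    obtain ⟨m', hm', hml⟩ := ih hl.2
    exact ⟨m * m', mul_ne_zero hm hm', by
      rw [Nat.cast_mul]
      exact Ideal.mul_mem_mul hmP hml⟩

/-- A finite module is killed by a product of annihilators of finite simple modules. -/
theorem exists_idealProd_smul_eq_zero (M : Type u) [AddCommGroup M] [Module R M] [Finite M] :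
    ∃ l : List (Ideal R), (∀ P ∈ l, IsSimpleAnnihilator P) ∧
      ∀ r ∈ idealProd l, ∀ x : M, r • x = 0 := by
  induction hd : Nat.card M using Nat.strong_induction_on generalizing M with
  | _ d ih =>
    subst hd
    rcases subsingleton_or_nontrivial M with h | h
    · exact ⟨[], by simp, fun r _ x => Subsingleton.elim _ _⟩
    · have : Finite (Submodule R M) := Finite.of_injective _ SetLike.coe_injective
      obtain ⟨S, hS⟩ := IsAtomic.exists_atom (Submodule R M)
      have : Finite (M ⧸ S) := Finite.of_surjective _ S.mkQ_surjective
      have hcard : Nat.card M = Nat.card S * Nat.card (M ⧸ S) :=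
        S.card_eq_card_quotient_mul_card
      have hS' := isSimpleModule_iff_isAtom.2 hS
      have : Nontrivial S := hS'.nontrivial
      have hlt : Nat.card (M ⧸ S) < Nat.card M := by
        rw [hcard]
        exact lt_mul_of_one_lt_left Nat.card_pos Finite.one_lt_card
      obtain ⟨l, hl, hkill⟩ := ih _ hlt (M ⧸ S) rfl
      let e := Shrink.linearEquiv.{0} R S
      refine ⟨Module.annihilator R (Shrink.{0} S) :: l, List.forall_mem_cons.2
        ⟨⟨Shrink.{0} S, inferInstance, inferInstance, .of_equiv _ e.symm.toEquiv, .congr e, rfl⟩,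
          hl⟩, fun r hr x => ?_⟩
      rw [idealProd_cons] at hr
      refine Submodule.smul_induction_on hr (fun a ha b hb => ?_) (fun a b ha hb => ?_)
      · have hbx : b • x ∈ S := (Submodule.Quotient.mk_eq_zero S).1 (hkill b hb (S.mkQ x))
        rw [e.annihilator_eq] at ha
        rw [smul_eq_mul, mul_smul]
        exact congrArg Subtype.val (Module.mem_annihilator.1 ha ⟨_, hbx⟩)
      · rw [add_smul, ha, hb, add_zero]

end Products

/-! ### Ideals with trivial multiplier rings: annihilators are invertible -/

section MaximalOrders

universe u v

variable {R : Type u} [Ring R] {A : Type v} [Ring A] (j : R →+* A)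

/-- Every two-sided ideal of `R` containing a positive integer has `R` as right and left
multiplier ring in `A`. -/
structure HasTrivialMultipliers : Prop where
  right : ∀ (B : Ideal R) (m : ℕ), B.IsTwoSided → m ≠ 0 → (m : R) ∈ B → ∀ x : A,
    (∀ b ∈ B, ∃ b' ∈ B, j b' = j b * x) → ∃ r, j r = x
  left : ∀ (B : Ideal R) (m : ℕ), B.IsTwoSided → m ≠ 0 → (m : R) ∈ B → ∀ x : A,
    (∀ b ∈ B, ∃ b' ∈ B, j b' = x * j b) → ∃ r, j r = x

variable {j} (hj : Function.Injective j) (hmul : HasTrivialMultipliers j)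
  (hunit : ∀ m : ℕ, m ≠ 0 → ∃ d : A, (m : A) * d = 1)
  (hfin : ∀ m : ℕ, m ≠ 0 → Finite (R ⧸ Ideal.span {(m : R)}))
include hj hmul hunit hfin

/-- Choose a shortest product of simple annihilators inside (m). Since (m) ≤ Q, it has the form B Q
C. By minimality C B is not inside (m), so some x in C B is not in (m), and y = x/m lies outside R.
For q in Q, B (q y) ⊆ B and (y q) C ⊆ C, so q y and y q lie in R by triviality of multipliers. -/
theorem exists_mem_idealInv_not_mem {Q : Ideal R} (hQ : IsSimpleAnnihilator Q) :
    ∃ y ∈ idealInv j Q, ¬ ∃ r, j r = y := by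
  obtain ⟨m, hm, hmQ⟩ := hQ.exists_natCast_mem
  let I : Ideal R := Ideal.span {(m : R)}
  have hI : ∀ x, x ∈ I ↔ ∃ s : R, x = m * s := fun x => by
    rw [Ideal.mem_span_singleton']
    exact ⟨fun ⟨s, hs⟩ => ⟨s, by rw [← hs, Nat.cast_comm]⟩,
      fun ⟨s, hs⟩ => ⟨s, by rw [hs, Nat.cast_comm]⟩⟩
  have hIQ : I ≤ Q := (Ideal.span_singleton_le_iff_mem Q).2 hmQ
  have := hfin m hm
  let p : ℕ → Prop := fun n => ∃ l : List (Ideal R), l.length = n ∧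
    (∀ P ∈ l, IsSimpleAnnihilator P) ∧ idealProd l ≤ I
  have hp : ∃ n, p n := by
    obtain ⟨l, hl, hkill⟩ := exists_idealProd_smul_eq_zero (R := R) (R ⧸ I)
    refine ⟨_, l, rfl, hl, fun r hr => ?_⟩
    have := hkill r hr (Submodule.Quotient.mk 1)
    rwa [← Submodule.Quotient.mk_smul, smul_eq_mul, mul_one, Submodule.Quotient.mk_eq_zero] at this
  classical
  obtain ⟨l, hlen, hl, hlI⟩ := Nat.find_spec hp
  have hmin := fun n => Nat.find_min (m := n) hp
  rw [← hlen] at hmin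
  obtain ⟨l₁, l₂, rfl⟩ := List.append_of_mem (hQ.mem_of_idealProd_le hl (hlI.trans hIQ))
  have hl₁ : ∀ P ∈ l₁, IsSimpleAnnihilator P := fun P hP => hl P (by simp [hP])
  have hl₂ : ∀ P ∈ l₂, IsSimpleAnnihilator P := fun P hP => hl P (by simp [hP])
  have hB := isTwoSided_idealProd hl₁
  have hC := isTwoSided_idealProd hl₂
  -- Dropping Q from the list shortens it, contradicting minimality.
  have hnot : ¬ idealProd l₂ * idealProd l₁ ≤ I := fun h =>
    hmin (l₂ ++ l₁).length (by simp; omega) ⟨l₂ ++ l₁, rfl, fun P hP => by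
      rcases List.mem_append.1 hP with h | h
      exacts [hl₂ P h, hl₁ P h], by rwa [idealProd_append]⟩
  rw [idealProd_append, idealProd_cons] at hlI
  have hBQC : ∀ b ∈ idealProd l₁, ∀ q ∈ Q, ∀ c ∈ idealProd l₂, ∃ s : R, b * q * c = m * s :=
    fun b hb q hq c hc => (hI _).1 <| hlI <| by
      rw [mul_assoc]
      exact Ideal.mul_mem_mul hb (Ideal.mul_mem_mul hq hc)
  obtain ⟨x, hx, hxI⟩ := SetLike.not_le_iff_exists.1 hnot
  obtain ⟨d, hd⟩ := hunit m hm
  have hd' : d * (m : A) = 1 := by rw [← Nat.cast_comm, hd]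
  have hdc : ∀ a : A, d * a = a * d := fun a => by
    calc d * a = d * (a * ((m : A) * d)) := by rw [hd, mul_one]
      _ = d * ((m : A) * a) * d := by rw [← mul_assoc a, ← Nat.cast_comm, ← mul_assoc]
      _ = a * d := by rw [← mul_assoc d, hd', one_mul]
  have hdm : ∀ s : R, d * j (m * s) = j s := fun s => by
    rw [map_mul, map_natCast, ← mul_assoc, hd', one_mul]
  obtain ⟨mB, hmB, hmB'⟩ := exists_natCast_mem_idealProd hl₁
  obtain ⟨mC, hmC, hmC'⟩ := exists_natCast_mem_idealProd hl₂
  refine ⟨d * j x, ⟨fun q hq => ?_, fun q hq => ?_⟩, fun ⟨r, hr⟩ => hxI ?_⟩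
  · refine hmul.right _ mB hB hmB hmB' _ fun b hb => ?_
    have key : ∃ b' ∈ idealProd l₁, b * q * x = m * b' := by
      refine Submodule.smul_induction_on hx (fun c hc b₁ hb₁ => ?_) ?_
      · obtain ⟨s, hs⟩ := hBQC b hb q hq c hc
        exact ⟨s * b₁, Ideal.mul_mem_left _ _ hb₁, by
          rw [smul_eq_mul, ← mul_assoc, hs, mul_assoc]⟩
      · rintro y z ⟨b₁, hb₁, h₁⟩ ⟨b₂, hb₂, h₂⟩
        exact ⟨b₁ + b₂, Ideal.add_mem _ hb₁ hb₂, by rw [mul_add, mul_add, h₁, h₂]⟩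
    obtain ⟨b', hb', h⟩ := key
    refine ⟨b', hb', ?_⟩
    rw [← hdm b', ← h, map_mul, map_mul, hdc, hdc]
    simp only [mul_assoc]
  · refine hmul.left _ mC hC hmC hmC' _ fun c hc => ?_
    have key : ∃ c' ∈ idealProd l₂, x * q * c = m * c' := by
      refine Submodule.smul_induction_on hx (fun c₁ hc₁ b hb => ?_) ?_
      · obtain ⟨s, hs⟩ := hBQC b hb q hq c hc
        exact ⟨c₁ * s, Ideal.mul_mem_right _ _ hc₁, by
          rw [smul_eq_mul, mul_assoc, mul_assoc, ← mul_assoc b, hs, ← mul_assoc, ← mul_assoc,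
            Nat.cast_comm]⟩
      · rintro y z ⟨b₁, hb₁, h₁⟩ ⟨b₂, hb₂, h₂⟩
        exact ⟨b₁ + b₂, Ideal.add_mem _ hb₁ hb₂, by rw [add_mul, add_mul, mul_add, h₁, h₂]⟩
    obtain ⟨c', hc', h⟩ := key
    refine ⟨c', hc', ?_⟩
    rw [← hdm c', ← h, map_mul, map_mul]
    simp only [mul_assoc]
  · rw [hI]
    refine ⟨r, hj ?_⟩
    rw [map_mul, map_natCast, hr, ← mul_assoc, hd, one_mul]

omit hj hmul hunit hfin in
/-- A proper two-sided ideal containing the annihilator `Q` of a finite simple module is `Q`. -/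
theorem eq_top_or_le_of_isSimpleAnnihilator {Q T : Ideal R} (hQ : IsSimpleAnnihilator Q)
    [T.IsTwoSided] (h : Q ≤ T) : T = ⊤ ∨ T ≤ Q := by
  obtain ⟨K, _, _, _, _, rfl⟩ := hQ
  by_cases hT : T = ⊤
  · exact .inl hT
  · right
    obtain ⟨N, hN, hTN⟩ := Ideal.exists_le_maximal T hT
    have : IsSimpleModule R (R ⧸ N) := isSimpleModule_iff_isCoatom.2 (Ideal.isMaximal_def.1 hN)
    have hkill : T ≤ Module.annihilator R (R ⧸ N) := fun t ht => by
      rw [Module.mem_annihilator]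
      intro x
      obtain ⟨x, rfl⟩ := N.mkQ_surjective x
      exact (Submodule.Quotient.mk_eq_zero N).2 (hTN (T.mul_mem_right x ht))
    rw [annihilator_eq_of_le (h.trans hkill)]
    exact hkill

omit hj hmul hunit hfin in
-- The preimage of C in R is a two-sided ideal containing Q, so by maximality it is R or Q.
theorem one_mem_or_of_isSimpleAnnihilator {Q : Ideal R} (hQ : IsSimpleAnnihilator Q)
    {C : AddSubmonoid A} (hCl : ∀ s, ∀ z ∈ C, j s * z ∈ C) (hCr : ∀ s, ∀ z ∈ C, z * j s ∈ C)
    (hQC : ∀ q ∈ Q, j q ∈ C) : 1 ∈ C ∨ ∀ r, j r ∈ C → r ∈ Q := by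
  let T : Ideal R :=
    { carrier := {r | j r ∈ C}
      add_mem' := fun {a b} ha hb => by
        rw [Set.mem_ofPred_eq, map_add]; exact C.add_mem ha hb
      zero_mem' := by rw [Set.mem_ofPred_eq, map_zero]; exact C.zero_mem
      smul_mem' := fun s a ha => by
        rw [Set.mem_ofPred_eq, smul_eq_mul, map_mul]; exact hCl s _ ha }
  have hT : T.IsTwoSided := ⟨fun {a} s ha => by
    change j (a * s) ∈ C
    rw [map_mul]; exact hCr s _ ha⟩
  rcases eq_top_or_le_of_isSimpleAnnihilator (T := T) hQ hQC with h | h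
  · left
    have : (1 : R) ∈ T := h ▸ trivial
    rw [← map_one j]
    exact this
  · exact .inr fun r hr => h hr

/-- If Q Q⁻¹ did not contain 1, its intersection with R would lie in Q. Then Q y₀ ⊆ Q for the y₀
outside R found above, and triviality of multipliers would put y₀ in R. The other side is symmetric.
-/
theorem isInvertibleIdeal_of_isSimpleAnnihilator {Q : Ideal R} (hQ : IsSimpleAnnihilator Q) :
    IsInvertibleIdeal j Q := by
  obtain ⟨y₀, hy₀, hy₀'⟩ := exists_mem_idealInv_not_mem hj hmul hunit hfin hQ
  obtain ⟨m, hm, hmQ⟩ := hQ.exists_natCast_mem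
  have hQ2 := hQ.isTwoSided
  have h1 : (1 : A) ∈ idealInv j Q := ⟨fun q _ => ⟨q, (mul_one _).symm⟩,
    fun q _ => ⟨q, (one_mul _).symm⟩⟩
  have hinv_right : ∀ y ∈ idealInv j Q, ∀ s, y * j s ∈ idealInv j Q := fun y hy s =>
    ⟨fun q hq => by
      obtain ⟨r, hr⟩ := hy.1 q hq
      exact ⟨r * s, by rw [map_mul, hr, mul_assoc]⟩, fun q hq => by
      obtain ⟨r, hr⟩ := hy.2 _ (Q.mul_mem_left s hq)
      exact ⟨r, by rw [hr, map_mul, mul_assoc]⟩⟩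
  have hinv_left : ∀ y ∈ idealInv j Q, ∀ s, j s * y ∈ idealInv j Q := fun y hy s =>
    ⟨fun q hq => by
      obtain ⟨r, hr⟩ := hy.1 _ (Q.mul_mem_right s hq)
      exact ⟨r, by rw [hr, map_mul, mul_assoc]⟩, fun q hq => by
      obtain ⟨r, hr⟩ := hy.2 q hq
      exact ⟨s * r, by rw [map_mul, hr, mul_assoc]⟩⟩
  constructor
  · let C := AddSubmonoid.closure {z | ∃ q ∈ Q, ∃ y ∈ idealInv j Q, z = j q * y}
    have hCl : ∀ s, ∀ z ∈ C, j s * z ∈ C := fun s z hz => by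
      induction hz using AddSubmonoid.closure_induction with
      | mem z hz =>
        obtain ⟨q, hq, y, hy, rfl⟩ := hz
        exact AddSubmonoid.subset_closure ⟨s * q, Q.mul_mem_left s hq, y, hy, by
          rw [map_mul, mul_assoc]⟩
      | zero => rw [mul_zero]; exact C.zero_mem
      | add a b _ _ ha hb => rw [mul_add]; exact C.add_mem ha hb
    have hCr : ∀ s, ∀ z ∈ C, z * j s ∈ C := fun s z hz => by
      induction hz using AddSubmonoid.closure_induction with
      | mem z hz =>
        obtain ⟨q, hq, y, hy, rfl⟩ := hz
        exact AddSubmonoid.subset_closure ⟨q, hq, _, hinv_right y hy s, by rw [mul_assoc]⟩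
      | zero => rw [zero_mul]; exact C.zero_mem
      | add a b _ _ ha hb => rw [add_mul]; exact C.add_mem ha hb
    rcases one_mem_or_of_isSimpleAnnihilator hQ hCl hCr fun q hq =>
      AddSubmonoid.subset_closure ⟨q, hq, 1, h1, (mul_one _).symm⟩ with h | h
    · exact h
    · refine absurd (hmul.right Q m hQ2 hm hmQ y₀ fun q hq => ?_) hy₀'
      obtain ⟨r, hr⟩ := hy₀.1 q hq
      exact ⟨r, h r (AddSubmonoid.subset_closure ⟨q, hq, y₀, hy₀, hr⟩), hr⟩
  · let C := AddSubmonoid.closure {z | ∃ q ∈ Q, ∃ y ∈ idealInv j Q, z = y * j q}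
    have hCr : ∀ s, ∀ z ∈ C, z * j s ∈ C := fun s z hz => by
      induction hz using AddSubmonoid.closure_induction with
      | mem z hz =>
        obtain ⟨q, hq, y, hy, rfl⟩ := hz
        exact AddSubmonoid.subset_closure ⟨q * s, Q.mul_mem_right s hq, y, hy, by
          rw [map_mul, mul_assoc]⟩
      | zero => rw [zero_mul]; exact C.zero_mem
      | add a b _ _ ha hb => rw [add_mul]; exact C.add_mem ha hb
    have hCl : ∀ s, ∀ z ∈ C, j s * z ∈ C := fun s z hz => by
      induction hz using AddSubmonoid.closure_induction with
      | mem z hz =>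
        obtain ⟨q, hq, y, hy, rfl⟩ := hz
        exact AddSubmonoid.subset_closure ⟨q, hq, _, hinv_left y hy s, by rw [mul_assoc]⟩
      | zero => rw [mul_zero]; exact C.zero_mem
      | add a b _ _ ha hb => rw [mul_add]; exact C.add_mem ha hb
    rcases one_mem_or_of_isSimpleAnnihilator hQ hCl hCr fun q hq =>
      AddSubmonoid.subset_closure ⟨q, hq, 1, h1, (one_mul _).symm⟩ with h | h
    · exact h
    · refine absurd (hmul.left Q m hQ2 hm hmQ y₀ fun q hq => ?_) hy₀'
      obtain ⟨r, hr⟩ := hy₀.2 q hq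
      exact ⟨r, h r (AddSubmonoid.subset_closure ⟨q, hq, y₀, hy₀, hr⟩), hr⟩

/-- For the last condition, M/N and QM/QN are simple and killed by Q = Ann(K), hence both are
isomorphic to K. -/
theorem isTwisting_of_isSimpleAnnihilator [IsNoetherianRing R] {Q : Ideal R}
    (hQ : IsSimpleAnnihilator Q) : IsTwisting Q := by
  have hinv := isInvertibleIdeal_of_isSimpleAnnihilator hj hmul hunit hfin hQ
  have hQ2 := hQ.isTwoSided
  refine ⟨fun M _ _ hM => ?_, fun n M => projective_smul_of_isInvertibleIdeal hj hinv M,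
    fun n N M => covBy_smul_of_isInvertibleIdeal hj hinv, fun n N M hNM hle => ?_⟩
  · obtain ⟨K, _, _, _, _, rfl⟩ := hQ
    exact isSemisimpleModule_of_annihilator_le (K := K) fun r hr =>
      Module.mem_annihilator.2 fun x => hM r hr x
  · have hcov := covBy_smul_of_isInvertibleIdeal hj hinv hNM
    have h₁ : IsSimpleModule R (M ⧸ N.submoduleOf M) := (covBy_iff_quot_is_simple hNM.le).1 hNM
    have h₂ : IsSimpleModule R ((Q • M : Submodule R (Fin n → R)) ⧸
        (Q • N).submoduleOf (Q • M)) := (covBy_iff_quot_is_simple hcov.le).1 hcov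
    have hk : ∀ (N M : Submodule R (Fin n → R)), Q • M ≤ N →
        Q ≤ Module.annihilator R (M ⧸ N.submoduleOf M) := fun N M h q hq => by
      rw [Module.mem_annihilator]
      intro x
      obtain ⟨x, rfl⟩ := Submodule.mkQ_surjective _ x
      exact (Submodule.Quotient.mk_eq_zero (N.submoduleOf M)).2
        (h (Submodule.smul_mem_smul hq x.2))
    have hk₁ := hk N M hle
    have hk₂ := hk (Q • N) (Q • M) (Submodule.smul_mono le_rfl hle)
    obtain ⟨K, _, _, _, _, rfl⟩ := hQ
    obtain ⟨e₁⟩ := nonempty_linearEquiv_of_annihilator_le hk₁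
    obtain ⟨e₂⟩ := nonempty_linearEquiv_of_annihilator_le hk₂
    exact ⟨e₁.trans e₂.symm⟩

theorem eulerOne_of_hasTrivialMultipliers [IsNoetherianRing R] : EulerOne R :=
  eulerOne_of_isTwisting fun K _ _ _ hK =>
    ⟨_, isTwisting_of_isSimpleAnnihilator hj hmul hunit hfin
      ⟨K, inferInstance, inferInstance, inferInstance, hK, rfl⟩,
      fun _ hr x => Module.mem_annihilator.1 hr x⟩

end MaximalOrders
end CLM

namespace CLM

/-! ### Maximal orders have trivial multiplier rings -/

section ZS

variable (S : Set Nat.Primes)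

theorem inv_natCast_den_mem_ZS (q : ZS S) : ((q : ℚ).den : ℚ)⁻¹ ∈ ZS S := by
  intro p hp h
  rw [Rat.inv_natCast_den_of_pos (Rat.den_pos _)] at h
  exact q.2 p hp h

/-- `den q * q = num q` in `ℤ_S`, where `den q` is a unit. -/
theorem exists_inv_den (q : ZS S) :
    ∃ d : ZS S, ((q : ℚ).den : ZS S) * d = 1 ∧ q = d * ((q : ℚ).num : ZS S) := by
  refine ⟨⟨_, inv_natCast_den_mem_ZS S q⟩, Subtype.ext ?_, Subtype.ext ?_⟩
  · simp [Rat.den_ne_zero]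
  · change (q : ℚ) = ((q : ℚ).den : ℚ)⁻¹ * ((q : ℚ).num : ℚ)
    rw [mul_comm, ← div_eq_mul_inv, Rat.num_div_den]

/-- Denominators are units, so an ideal is determined by its integers; chains of ideals inject
strictly into those of ℤ. -/
instance isNoetherianRing_ZS : IsNoetherianRing (ZS S) := by
  have h : ∀ I J : Ideal (ZS S), I.comap (Int.castRingHom (ZS S)) ≤ J.comap (Int.castRingHom _) →
      I ≤ J := by
    intro I J h q hq
    obtain ⟨d, hd, hqd⟩ := exists_inv_den S q
    have hnum : ((q : ℚ).num : ZS S) = ((q : ℚ).den : ZS S) * q := by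
      rw [hqd, ← mul_assoc]
      have : ((d * ((q : ℚ).num : ZS S) : ZS S) : ℚ) = q := by rw [← hqd]
      rw [this, hd, one_mul]
    have h1 : (q : ℚ).num ∈ I.comap (Int.castRingHom (ZS S)) := by
      change ((q : ℚ).num : ZS S) ∈ I
      rw [hnum]
      exact I.mul_mem_left _ hq
    rw [hqd]
    exact J.mul_mem_left _ (h h1)
  have hmono : StrictMono fun I : Ideal (ZS S) => I.comap (Int.castRingHom (ZS S)) :=
    fun I J hIJ => lt_of_le_not_ge (Ideal.comap_mono hIJ.le) fun hJI => hIJ.not_ge (h _ _ hJI)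
  exact isNoetherian_iff'.2 hmono.wellFoundedGT

/-- The image of ℤ in the quotient is finite. A denominator acts on it injectively, hence
surjectively, so fractions already have integer representatives. -/
theorem finite_quotient_ZS {m : ℕ} (hm : m ≠ 0) : Finite (ZS S ⧸ Ideal.span {(m : ZS S)}) := by
  let Q := ZS S ⧸ Ideal.span {(m : ZS S)}
  have hm0 : (m : Q) = 0 := by
    have : Ideal.Quotient.mk (Ideal.span {(m : ZS S)}) (m : ZS S) = 0 :=
      Ideal.Quotient.eq_zero_iff_mem.2 (Ideal.mem_span_singleton_self _)
    rw [← this, map_natCast]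
  let Z : Set Q := Set.range (fun a : ℤ => (a : Q))
  have hZ : Z.Finite := by
    refine ((Set.finite_Icc (0 : ℤ) m).image (fun a : ℤ => (a : Q))).subset ?_
    rintro _ ⟨a, rfl⟩
    have hm' : (m : ℤ) ≠ 0 := by exact_mod_cast hm
    refine ⟨a % m, ⟨Int.emod_nonneg a hm', ?_⟩, ?_⟩
    · exact (Int.emod_lt_of_pos a (by positivity)).le
    · have := congrArg (Int.cast : ℤ → Q) (Int.emod_add_mul_ediv a m)
      simpa [hm0] using this
  suffices Z = Set.univ by
    rw [this] at hZ
    exact Set.finite_univ_iff.1 hZ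
  refine Set.eq_univ_of_forall fun x => ?_
  obtain ⟨q, rfl⟩ := Ideal.Quotient.mk_surjective x
  obtain ⟨d, hd, hqd⟩ := exists_inv_den S q
  have hd' := congrArg (Ideal.Quotient.mk (Ideal.span {(m : ZS S)})) hd
  rw [map_mul, map_natCast, map_one] at hd'
  have := hZ.to_subtype
  let f : Z → Z := fun z => ⟨((q : ℚ).den : Q) * z, by
    obtain ⟨_, a, rfl⟩ := z
    exact ⟨(q : ℚ).den * a, Int.cast_mul _ _⟩⟩
  have hf : Function.Injective f := fun z w h => by
    have h1 : ((q : ℚ).den : Q) * z = ((q : ℚ).den : Q) * w := congrArg Subtype.val h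
    have h2 := congrArg (Ideal.Quotient.mk (Ideal.span {(m : ZS S)}) d * ·) h1
    simp only [← mul_assoc, mul_comm _ ((q : ℚ).den : Q), hd', one_mul] at h2
    exact Subtype.ext h2
  obtain ⟨z, hz⟩ := Finite.surjective_of_injective hf ⟨((q : ℚ).num : Q), _, rfl⟩
  have hz' : ((q : ℚ).den : Q) * z = ((q : ℚ).num : Q) := congrArg Subtype.val hz
  have : Ideal.Quotient.mk (Ideal.span {(m : ZS S)}) q = z := by
    have h3 : Ideal.Quotient.mk (Ideal.span {(m : ZS S)}) q =
        Ideal.Quotient.mk (Ideal.span {(m : ZS S)}) d * ((q : ℚ).num : Q) := by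
      conv_lhs => rw [hqd]
      rw [map_mul, map_intCast]
    rw [h3, ← hz', ← mul_assoc, mul_comm _ ((q : ℚ).den : Q), hd', one_mul]
  rw [this]
  exact z.2

end ZS

/-! ### Orders in a ℚ-algebra and their multiplier rings -/

section Orders

universe u

variable {A : Type u} [Ring A] [Algebra ℚ A] {S : Set Nat.Primes} {O : Subalgebra (ZS S) A}

theorem exists_natCast_mul_eq_one (m : ℕ) (hm : m ≠ 0) : ∃ d : A, (m : A) * d = 1 :=
  ⟨algebraMap ℚ A (m : ℚ)⁻¹, by
    rw [← map_natCast (algebraMap ℚ A), ← map_mul, mul_inv_cancel₀ (Nat.cast_ne_zero.2 hm),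
      map_one]⟩

theorem IsOrder.finite (hO : IsOrder O) : Module.Finite (ZS S) O :=
  Module.Finite.iff_fg.2 hO.1

theorem IsOrder.isNoetherianRing (hO : IsOrder O) : IsNoetherianRing O := by
  have := hO.finite
  have : IsNoetherian (ZS S) O := isNoetherian_of_isNoetherianRing_of_finite _ _
  exact isNoetherian_of_tower (ZS S) this

theorem IsOrder.finite_quotient (hO : IsOrder O) (m : ℕ) (hm : m ≠ 0) :
    Finite (O ⧸ Ideal.span {(m : O)}) := by
  have := hO.finite
  obtain ⟨n, f, hf⟩ := Module.Finite.exists_fin' (ZS S) O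
  have := finite_quotient_ZS S hm
  let s : (ZS S ⧸ Ideal.span {(m : ZS S)}) → ZS S := Quotient.out
  refine Finite.of_surjective (fun a : Fin n → ZS S ⧸ Ideal.span {(m : ZS S)} =>
    Submodule.Quotient.mk (p := Ideal.span {(m : O)}) (f fun i => s (a i))) fun x => ?_
  obtain ⟨x, rfl⟩ := Submodule.mkQ_surjective _ x
  obtain ⟨v, rfl⟩ := hf x
  refine ⟨fun i => Ideal.Quotient.mk _ (v i), ?_⟩
  refine (Submodule.Quotient.eq _).2 ?_
  have : ∀ i, ∃ c, s (Ideal.Quotient.mk _ (v i)) - v i = c * (m : ZS S) := fun i => by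
    have : s (Ideal.Quotient.mk _ (v i)) - v i ∈ Ideal.span {(m : ZS S)} :=
      Ideal.Quotient.eq.1 (Quotient.out_eq _)
    obtain ⟨c, hc⟩ := Ideal.mem_span_singleton'.1 this
    exact ⟨c, hc.symm⟩
  choose c hc using this
  rw [← map_sub, Ideal.mem_span_singleton']
  refine ⟨f c, ?_⟩
  have : (fun i => s (Ideal.Quotient.mk _ (v i))) - v = (m : ZS S) • c := by
    ext1 i
    rw [Pi.sub_apply, hc, Pi.smul_apply, smul_eq_mul, mul_comm]
  rw [this, map_smul, ← Nat.cast_comm, Nat.cast_smul_eq_nsmul, nsmul_eq_mul]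

/-- A subalgebra containing an order and contained in a fractional multiple of it is an order. -/
theorem IsOrder.of_mul_mem {O' : Subalgebra (ZS S) A} (hO : IsOrder O) (hle : O ≤ O') {m : ℕ}
    (hm : m ≠ 0) (h : ∀ x ∈ O', (m : A) * x ∈ O) : IsOrder O' := by
  have := hO.finite
  have hnoeth : IsNoetherian (ZS S) (Subalgebra.toSubmodule O) :=
    isNoetherian_of_isNoetherianRing_of_finite (ZS S) O
  obtain ⟨d, hd⟩ := exists_natCast_mul_eq_one (A := A) m hm
  have hd' : d * (m : A) = 1 := by rw [← Nat.cast_comm, hd]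
  refine ⟨?_, top_le_iff.1 (hO.2 ▸ Submodule.span_mono hle)⟩
  have hL : (Subalgebra.toSubmodule O').map (LinearMap.mulLeft (ZS S) (m : A)) ≤
      Subalgebra.toSubmodule O := by
    rintro _ ⟨x, hx, rfl⟩
    exact h x hx
  have hfg := (isNoetherian_submodule.1 hnoeth _ hL).map (LinearMap.mulLeft (ZS S) d)
  rwa [← Submodule.map_comp, ← LinearMap.mulLeft_mul, hd', LinearMap.mulLeft_one,
    Submodule.map_id] at hfg

/-- The elements x with B x ⊆ B form a ring O' containing O. As m ∈ B, m O' ⊆ B ⊆ O, so O' is an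
order and equals O by maximality. Likewise on the left. -/
theorem IsMaximalOrder.hasTrivialMultipliers (hO : IsMaximalOrder O) :
    HasTrivialMultipliers (O.val : O →+* A) := by
  constructor
  · intro B m hB hm hmB x hx
    let O' : Subalgebra (ZS S) A :=
      { carrier := {x | ∀ b ∈ B, ∃ b' ∈ B, (b' : A) = (b : A) * x}
        mul_mem' := by
          intro x y hx hy b hb
          obtain ⟨b₁, hb₁, h₁⟩ := hx b hb
          obtain ⟨b₂, hb₂, h₂⟩ := hy b₁ hb₁
          exact ⟨b₂, hb₂, by rw [h₂, h₁, mul_assoc]⟩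
        add_mem' := by
          intro x y hx hy b hb
          obtain ⟨b₁, hb₁, h₁⟩ := hx b hb
          obtain ⟨b₂, hb₂, h₂⟩ := hy b hb
          exact ⟨b₁ + b₂, B.add_mem hb₁ hb₂, by rw [mul_add, ← h₁, ← h₂]; rfl⟩
        algebraMap_mem' := fun r b hb =>
          ⟨b * algebraMap (ZS S) O r, B.mul_mem_right _ hb, rfl⟩ }
    have hle : O ≤ O' := fun a ha b hb => ⟨b * ⟨a, ha⟩, B.mul_mem_right _ hb, rfl⟩
    have hO' : IsOrder O' := hO.1.of_mul_mem hle hm fun x hx => by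
      obtain ⟨b, -, hb⟩ := hx _ hmB
      have : (m : A) * x = b := hb.symm
      rw [this]
      exact b.2
    exact ⟨⟨x, hO.2 hO' hle hx⟩, rfl⟩
  · intro B m hB hm hmB x hx
    let O' : Subalgebra (ZS S) A :=
      { carrier := {x | ∀ b ∈ B, ∃ b' ∈ B, (b' : A) = x * (b : A)}
        mul_mem' := by
          intro x y hx hy b hb
          obtain ⟨b₁, hb₁, h₁⟩ := hy b hb
          obtain ⟨b₂, hb₂, h₂⟩ := hx b₁ hb₁
          exact ⟨b₂, hb₂, by rw [h₂, h₁, mul_assoc]⟩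
        add_mem' := by
          intro x y hx hy b hb
          obtain ⟨b₁, hb₁, h₁⟩ := hx b hb
          obtain ⟨b₂, hb₂, h₂⟩ := hy b hb
          exact ⟨b₁ + b₂, B.add_mem hb₁ hb₂, by rw [add_mul, ← h₁, ← h₂]; rfl⟩
        algebraMap_mem' := fun r b hb =>
          ⟨algebraMap (ZS S) O r * b, B.mul_mem_left _ hb, rfl⟩ }
    have hle : O ≤ O' := fun a ha b hb => ⟨⟨a, ha⟩ * b, B.mul_mem_left _ hb, rfl⟩
    have hO' : IsOrder O' := hO.1.of_mul_mem hle hm fun x hx => by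
      obtain ⟨b, -, hb⟩ := hx _ hmB
      have : (m : A) * x = b := by
        rw [Nat.cast_comm]
        exact hb.symm
      rw [this]
      exact b.2
    exact ⟨⟨x, hO.2 hO' hle hx⟩, rfl⟩

theorem IsMaximalOrder.eulerOne (hO : IsMaximalOrder O) : EulerOne O := by
  have := hO.1.isNoetherianRing
  exact eulerOne_of_hasTrivialMultipliers (j := (O.val : O →+* A)) Subtype.val_injective
    hO.hasTrivialMultipliers exists_natCast_mul_eq_one hO.1.finite_quotient

end Orders
end CLM

namespace CLM

/-! ### Weights -/

section FixedPoints

variable {R : Type*} [Ring R]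

theorem card_eq_mul_of_exact {K G H : Type*} [AddCommGroup K] [AddCommGroup G] [AddCommGroup H]
    (i : K →+ G) (p : G →+ H) (hi : Function.Injective i) (hip : Function.Exact i p)
    (K₀ : AddSubgroup K) (G₀ : AddSubgroup G) (H₀ : AddSubgroup H)
    (hK : ∀ k, i k ∈ G₀ ↔ k ∈ K₀) (hG : ∀ g ∈ G₀, p g ∈ H₀)
    (hH : ∀ h ∈ H₀, ∃ g ∈ G₀, p g = h) :
    Nat.card G₀ = Nat.card K₀ * Nat.card H₀ := by
  let f : G₀ →+ H₀ := (p.comp G₀.subtype).codRestrict H₀ fun g => hG g g.2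
  have hf : Function.Surjective f := by
    rintro ⟨h, hh⟩
    obtain ⟨g, hg, rfl⟩ := hH h hh
    exact ⟨⟨g, hg⟩, rfl⟩
  rw [natCard_eq_card_ker_mul_card_range f, AddMonoidHom.range_eq_top.2 hf, AddSubgroup.card_top]
  congr 1
  refine (Nat.card_congr (Equiv.ofBijective
    (fun k : K₀ => (⟨⟨i k, (hK k).2 k.2⟩, ?_⟩ : f.ker)) ⟨fun k k' h => ?_, ?_⟩)).symm
  · rw [AddMonoidHom.mem_ker]
    exact Subtype.ext ((hip _).2 ⟨k, rfl⟩)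
  · have := congrArg (fun x : f.ker => (x : G₀).1) h
    exact Subtype.ext (hi this)
  · rintro ⟨⟨g, hg⟩, hgf⟩
    have : p g = 0 := congrArg Subtype.val (AddMonoidHom.mem_ker.1 hgf)
    obtain ⟨k, rfl⟩ := (hip g).1 this
    exact ⟨⟨k, (hK k).1 hg⟩, rfl⟩

variable {e : R} (he : e * e = e) (hc : ∀ r : R, e * r = r * e)
include he

theorem mem_component_iff {M : Type*} [AddCommGroup M] [Module R M] (x : M) :
    x ∈ component e hc M ↔ e • x = x :=
  ⟨by rintro ⟨y, rfl⟩; rw [smul_smul, he], fun h => ⟨x, h⟩⟩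

/-- For a central idempotent e, M ↦ eM is an exact functor: membership means e x = x, and a preimage
g of a fixed element can be replaced by e g. -/
theorem card_component_eq_mul {K G H : Type*} [AddCommGroup K] [Module R K] [AddCommGroup G]
    [Module R G] [AddCommGroup H] [Module R H] (i : K →ₗ[R] G) (p : G →ₗ[R] H)
    (hi : Function.Injective i) (hp : Function.Surjective p) (hip : Function.Exact i p) :
    Nat.card (component e hc G) = Nat.card (component e hc K) * Nat.card (component e hc H) := by
  refine card_eq_mul_of_exact i.toAddMonoidHom p.toAddMonoidHom hi hip
    (component e hc K).toAddSubgroup (component e hc G).toAddSubgroup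
    (component e hc H).toAddSubgroup (fun k => ?_) (fun g hg => ?_) fun h hh => ?_
  · change i k ∈ component e hc G ↔ k ∈ component e hc K
    rw [mem_component_iff he, mem_component_iff he, ← map_smul, hi.eq_iff]
  · obtain ⟨y, rfl⟩ := hg
    exact ⟨p y, (map_smul p e y).symm⟩
  · obtain ⟨y, rfl⟩ := hh
    obtain ⟨g, rfl⟩ := hp y
    exact ⟨e • g, ⟨g, rfl⟩, map_smul p e g⟩

/-- Surjections from `eG` to a module `H = eH` are the same as surjections from `G`. -/
theorem numSur_component {G H : Type*} [AddCommGroup G] [Module R G] [AddCommGroup H] [Module R H]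
    (hH : component e hc H = ⊤) : numSur R (component e hc G) H = numSur R G H := by
  have hH' : ∀ h : H, e • h = h := fun h =>
    (mem_component_iff he hc h).1 (hH ▸ Submodule.mem_top)
  let π : G →ₗ[R] component e hc G :=
    { toFun := fun x => ⟨e • x, x, rfl⟩
      map_add' := fun x y => Subtype.ext (smul_add _ _ _)
      map_smul' := fun r x => Subtype.ext (by
        change e • r • x = r • e • x
        rw [smul_smul, hc, ← smul_smul]) }
  have hπ : ∀ x : component e hc G, π x = x := fun x =>
    Subtype.ext ((mem_component_iff he hc x.1).1 x.2)
  rw [numSur, numSur, Nat.card_congr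
    (⟨fun f => ⟨f.1 ∘ₗ π, f.2.comp fun x => ⟨x, hπ x⟩⟩,
      fun g => ⟨g.1 ∘ₗ (component e hc G).subtype, fun h => ?_⟩,
      fun f => ?_, fun g => ?_⟩ : {f : component e hc G →ₗ[R] H // Function.Surjective f} ≃
        {f : G →ₗ[R] H // Function.Surjective f})]
  · obtain ⟨x, rfl⟩ := g.2 h
    exact ⟨π x, (map_smul g.1 e x).trans (hH' _)⟩
  · refine Subtype.ext (LinearMap.ext fun x => ?_)
    exact congrArg f.1 (hπ x)
  · refine Subtype.ext (LinearMap.ext fun x => ?_)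
    exact (map_smul g.1 e x).trans (hH' _)

theorem numSur_component_eq_zero {G H : Type*} [AddCommGroup G] [Module R G] [AddCommGroup H]
    [Module R H] (hH : component e hc H ≠ ⊤) : numSur R (component e hc G) H = 0 := by
  have : IsEmpty {f : component e hc G →ₗ[R] H // Function.Surjective f} := ⟨fun f => hH <| by
    rw [eq_top_iff]
    rintro h -
    obtain ⟨x, rfl⟩ := f.2 h
    refine ⟨f.1 x, ?_⟩
    rw [← map_smul]
    exact congrArg f.1 (Subtype.ext ((mem_component_iff he hc x.1).1 x.2))⟩
  rw [numSur]
  simp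

end FixedPoints

section CardPow

universe u

variable {A : Type u} [Ring A] [Algebra ℚ A] {S : Set Nat.Primes} {O : Subalgebra (ZS S) A}
  (hO : IsMaximalOrder O) (u : IrrIdem A → ℚ)

theorem card_irrComponent_ne_zero (i : IrrIdem A) (G : Type*) [AddCommGroup G] [Module O G]
    [Finite G] : (Nat.card (irrComponent hO i G) : ℝ≥0∞) ≠ 0 :=
  Nat.cast_ne_zero.2 Nat.card_pos.ne'

theorem cardPow_congr {G G' : Type*} [AddCommGroup G] [Module O G] [AddCommGroup G']
    [Module O G'] (f : G ≃ₗ[O] G') : cardPow hO u G = cardPow hO u G' := by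
  rw [cardPow, cardPow]
  refine finprod_congr fun a => ?_
  congr 2
  refine Nat.card_congr (Equiv.subtypeEquiv f.toEquiv fun x => ?_)
  change x ∈ component _ _ G ↔ f x ∈ component _ _ G'
  rw [mem_component_iff (Subtype.ext a.2.idem), mem_component_iff (Subtype.ext a.2.idem),
    ← map_smul, f.injective.eq_iff]

variable [Module.Finite ℚ A]

theorem cardPow_ne (G : Type*) [AddCommGroup G] [Module O G] [Finite G] :
    cardPow hO u G ≠ 0 ∧ cardPow hO u G ≠ ⊤ := by
  have := finite_irrIdem (A := A)
  have := Fintype.ofFinite (IrrIdem A)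
  rw [cardPow, finprod_eq_prod_of_fintype]
  constructor
  · refine Finset.prod_ne_zero_iff.2 fun i _ => ?_
    exact (ENNReal.rpow_pos (pos_iff_ne_zero.2 (card_irrComponent_ne_zero hO i G))
      (ENNReal.natCast_ne_top _)).ne'
  · refine ENNReal.prod_ne_top fun i _ => ?_
    exact ENNReal.rpow_ne_top_of_ne_zero (card_irrComponent_ne_zero hO i G)
      (ENNReal.natCast_ne_top _)

theorem cardPow_eq_mul {K G H : Type*} [AddCommGroup K] [Module O K] [AddCommGroup G]
    [Module O G] [AddCommGroup H] [Module O H] (i : K →ₗ[O] G) (p : G →ₗ[O] H)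
    (hi : Function.Injective i) (hp : Function.Surjective p) (hip : Function.Exact i p) :
    cardPow hO u G = cardPow hO u K * cardPow hO u H := by
  have := finite_irrIdem (A := A)
  have := Fintype.ofFinite (IrrIdem A)
  simp only [cardPow, finprod_eq_prod_of_fintype]
  rw [← Finset.prod_mul_distrib]
  refine Finset.prod_congr rfl fun a _ => ?_
  rw [irrComponent, card_component_eq_mul (Subtype.ext a.2.idem) _ i p hi hp hip, Nat.cast_mul,
    ENNReal.mul_rpow_of_ne_top (ENNReal.natCast_ne_top _) (ENNReal.natCast_ne_top _)]
  rfl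

end CardPow

/-! ### Invariants under a subgroup of invertible order -/

section Invariants

variable {Γ : Type*} [Group Γ] (Δ : Subgroup Γ)

theorem card_invariants_congr {G G' : Type*} [AddCommGroup G] [Module (AwayGroupRing Γ) G]
    [AddCommGroup G'] [Module (AwayGroupRing Γ) G'] (f : G ≃ₗ[AwayGroupRing Γ] G') :
    Nat.card (invariants Δ G) = Nat.card (invariants Δ G') := by
  refine Nat.card_congr (Equiv.subtypeEquiv f.toEquiv fun x => ?_)
  refine forall₂_congr fun γ hγ => ?_
  change _ ↔ _ • f x = f x
  rw [← map_smul, f.injective.eq_iff]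

variable [Finite Γ]

/-- Only lifting invariant elements along p needs an argument: average an arbitrary preimage over Δ.
-/
theorem card_invariants_eq_mul {K G H : Type*} [AddCommGroup K] [Module (AwayGroupRing Γ) K]
    [AddCommGroup G] [Module (AwayGroupRing Γ) G] [AddCommGroup H] [Module (AwayGroupRing Γ) H]
    (i : K →ₗ[AwayGroupRing Γ] G) (p : G →ₗ[AwayGroupRing Γ] H)
    (hi : Function.Injective i) (hp : Function.Surjective p) (hip : Function.Exact i p) :
    Nat.card (invariants Δ G) = Nat.card (invariants Δ K) * Nat.card (invariants Δ H) := by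
  refine card_eq_mul_of_exact i.toAddMonoidHom p.toAddMonoidHom hi hip _ _ _
    (fun k => ?_) (fun g hg γ hγ => ?_) fun h hh => ?_
  · refine forall₂_congr fun γ hγ => ?_
    change _ • i k = i k ↔ _
    rw [← map_smul, hi.eq_iff]
  · change _ • p g = p g
    rw [← map_smul, hg γ hγ]
  · obtain ⟨g, rfl⟩ := hp h
    have := Fintype.ofFinite Δ
    obtain ⟨n, hn⟩ := Δ.card_subgroup_dvd_card
    obtain ⟨v, hv⟩ := (isUnit_card_away Γ).exists_left_inv
    -- This is 1/|Δ|, obtained as n/|Γ| with |Γ| = |Δ| n.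
    let c : AwayGroupRing Γ := algebraMap (Localization.Away (Nat.card Γ : ℤ)) _ (v * (n : _))
    have hcomm : ∀ x : AwayGroupRing Γ, c * x = x * c := fun x => Algebra.commutes _ _
    have hcΔ : c * (Nat.card Δ : AwayGroupRing Γ) = 1 := by
      have h1 : (v * n) * (Nat.card Δ : Localization.Away (Nat.card Γ : ℤ)) = 1 := by
        rw [mul_assoc, ← Nat.cast_mul, mul_comm n, ← hn, hv]
      have h2 := congrArg (algebraMap _ (AwayGroupRing Γ)) h1
      rwa [map_mul, map_natCast, map_one] at h2
    let of := MonoidAlgebra.of (Localization.Away (Nat.card Γ : ℤ)) Γ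
    refine ⟨c • ∑ δ : Δ, of δ • g, fun γ hγ => ?_, ?_⟩
    · change of γ • _ = _
      rw [smul_smul, ← hcomm, ← smul_smul, Finset.smul_sum]
      congr 1
      refine Fintype.sum_equiv (Equiv.mulLeft (⟨γ, hγ⟩ : Δ)) _ _ fun δ => ?_
      rw [smul_smul, ← map_mul]
      rfl
    · change p _ = p g
      rw [map_smul, map_sum]
      have : ∀ δ : Δ, p (of δ • g) = p g := fun δ => by
        rw [map_smul]
        exact hh δ δ.2
      rw [Finset.sum_congr rfl fun δ _ => this δ, Finset.sum_const, Finset.card_univ,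
        Fintype.card_eq_nat_card, ← Nat.cast_smul_eq_nsmul (AwayGroupRing Γ), smul_smul, hcΔ,
        one_smul]

end Invariants

/-! ### The moments -/

section Main

universe u v w

theorem expect_numSur_of_isCLMRandomModule {A : Type u} [Ring A] [Algebra ℚ A]
    [Module.Finite ℚ A] {S : Set Nat.Primes} {O : Subalgebra (ZS S) A} (hO : IsMaximalOrder O)
    (u : IrrIdem A → ℚ) {Ω : Type v} (P : PMF Ω) (X : Ω → Type w) [∀ ω, AddCommGroup (X ω)]
    [∀ ω, Module O (X ω)] (hX : IsCLMRandomModule hO u P X) (H : Type*) [AddCommGroup H]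
    [Module O H] [Finite H] :
    expect P (fun ω => numSur O (X ω) H) = (cardPow hO u H)⁻¹ := by
  obtain ⟨hfin, hratio⟩ := hX
  -- The values of X and the target H are finite, so they are replaced by copies in `Type`, where
  -- the general moment formula is stated.
  have hsmall : ∀ ω, Small.{0} (X ω) := fun ω => inferInstance
  let _ : ∀ ω, AddCommGroup (Shrink.{0} (X ω)) := fun ω => inferInstance
  let _ : ∀ ω, Module O (Shrink.{0} (X ω)) := fun ω => inferInstance
  let eX : ∀ ω, Shrink.{0} (X ω) ≃ₗ[O] X ω := fun ω => Shrink.linearEquiv.{0} O (X ω)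
  let eH := Shrink.linearEquiv.{0} O H
  have : Finite (Shrink.{0} H) := .of_equiv _ eH.symm.toEquiv
  have hfinY : ∀ ω, Finite (Shrink.{0} (X ω)) := fun ω => .of_equiv _ (eX ω).symm.toEquiv
  let a := cardPow hO u PUnit * numAut O PUnit
  have hne := cardPow_ne hO u PUnit
  have ha : a ≠ 0 := mul_ne_zero hne.1 (numAut_ne_zero _)
  have ha' : a ≠ ⊤ := ENNReal.mul_ne_top hne.2 (numAut_ne_top _)
  let p₀ := probIso O P X PUnit
  -- In [0, ∞] both 0/0 and ∞/∞ are 0, so the ratio condition for the zero module against itself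
  -- forces 0 < p₀ < ∞. The constant of the distribution is then p₀ a.
  have h₀ : p₀ / p₀ = 1 := (hratio PUnit PUnit).trans (ENNReal.div_self ha ha')
  have hp₀ : p₀ ≠ 0 := fun h => by simp [h] at h₀
  have hp₀' : p₀ ≠ ⊤ := fun h => by simp [h] at h₀
  have hP : ∀ (G : Type) [AddCommGroup G] [Module O G] [Finite G], True →
      probIso O P (fun ω => Shrink.{0} (X ω)) G = (p₀ * a) / (cardPow hO u G * numAut O G) := by
    intro G _ _ _ _
    rw [← probIso_congr P X (fun ω => (eX ω).symm) (.refl O G), mul_div_assoc, ← hratio G PUnit,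
      ENNReal.mul_div_cancel hp₀ hp₀']
  rw [cardPow_congr hO u eH.symm, ← expect_numSur_eq P (fun ω => Shrink.{0} (X ω)) hO.eulerOne
    (fun _ _ _ => True) (fun G _ _ => cardPow hO u G) (fun G _ _ _ => cardPow_ne hO u G)
    (fun K G H _ _ _ _ _ _ _ _ _ i p hi hp hip => cardPow_eq_mul hO u i p hi hp hip)
    (fun _ _ _ _ _ _ _ _ _ _ _ _ _ _ _ _ _ _ _ => trivial) (fun _ _ _ _ _ _ _ _ _ _ => trivial)
    (fun ω => ⟨hfinY ω, trivial⟩) (p₀ * a) hP (Shrink.{0} H) trivial]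
  congr 1
  ext ω
  rw [numSur_congr (eX ω).symm, numSur_congr_right eH.symm]

theorem expect_numSur_of_isCLMForGaloisFields {Γ : Type u} [Group Γ] [Finite Γ]
    (Γinf : Subgroup Γ) {Ω : Type v} (P : PMF Ω) (X : Ω → Type w) [∀ ω, AddCommGroup (X ω)]
    [∀ ω, Module (AwayGroupRing Γ) (X ω)] (hX : IsCLMForGaloisFields Γinf P X) (H : Type*)
    [AddCommGroup H] [Module (AwayGroupRing Γ) H] [Finite H]
    (hH : invariants (⊤ : Subgroup Γ) H = ⊥) :
    expect P (fun ω => numSur (AwayGroupRing Γ) (X ω) H) =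
      (Nat.card (invariants Γinf H) : ℝ≥0∞)⁻¹ := by
  obtain ⟨hX, c, hP⟩ := hX
  have hfin := fun ω => (hX ω).1
  have hsmall : ∀ ω, Small.{0} (X ω) := fun ω => inferInstance
  let _ : ∀ ω, AddCommGroup (Shrink.{0} (X ω)) := fun ω => inferInstance
  let _ : ∀ ω, Module (AwayGroupRing Γ) (Shrink.{0} (X ω)) := fun ω => inferInstance
  let eX : ∀ ω, Shrink.{0} (X ω) ≃ₗ[AwayGroupRing Γ] X ω := fun ω => Shrink.linearEquiv.{0} (AwayGroupRing Γ) (X ω)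
  let eH := Shrink.linearEquiv.{0} (AwayGroupRing Γ) H
  have : Finite (Shrink.{0} H) := .of_equiv _ eH.symm.toEquiv
  have hfinY : ∀ ω, Finite (Shrink.{0} (X ω)) := fun ω => .of_equiv _ (eX ω).symm.toEquiv
  have hP' : ∀ (G : Type) [AddCommGroup G] [Module (AwayGroupRing Γ) G] [Finite G],
      Nat.card (invariants (⊤ : Subgroup Γ) G) = 1 →
      probIso (AwayGroupRing Γ) P (fun ω => Shrink.{0} (X ω)) G =
        c / ((Nat.card (invariants Γinf G) : ℝ≥0∞) * numAut (AwayGroupRing Γ) G) := by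
    intro G _ _ _ hG
    rw [← probIso_congr P X (fun ω => (eX ω).symm) (.refl _ G), hP G (AddSubgroup.card_eq_one.1 hG)]
  -- The condition of having no nonzero Γ-invariants is phrased as having exactly one invariant, so
  -- that closure under extensions follows from multiplicativity.
  rw [card_invariants_congr Γinf eH.symm, ← expect_numSur_eq P (fun ω => Shrink.{0} (X ω))
    eulerOne_awayGroupRing (fun G _ _ => Nat.card (invariants (⊤ : Subgroup Γ) G) = 1)
    (fun G _ _ => (Nat.card (invariants Γinf G) : ℝ≥0∞))
    (fun G _ _ _ => ⟨Nat.cast_ne_zero.2 Nat.card_pos.ne', ENNReal.natCast_ne_top _⟩)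
    (fun K G H _ _ _ _ _ _ _ _ _ i p hi hp hip => by
      rw [card_invariants_eq_mul Γinf i p hi hp hip, Nat.cast_mul])
    (fun K G H _ _ _ _ _ _ _ _ _ i p hi hp hip hK hH => by
      rw [card_invariants_eq_mul ⊤ i p hi hp hip, hK, hH])
    (fun K G _ _ _ _ _ i hi hG => ?_)
    (fun ω => ⟨hfinY ω, by
      rw [card_invariants_congr ⊤ (eX ω), AddSubgroup.card_eq_one]
      exact (hX ω).2⟩) c hP' (Shrink.{0} H) (by
      rw [card_invariants_congr ⊤ eH, AddSubgroup.card_eq_one]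
      exact hH)]
  · congr 1
    ext ω
    rw [numSur_congr (eX ω).symm, numSur_congr_right eH.symm]
  · rw [AddSubgroup.card_eq_one, AddSubgroup.eq_bot_iff_forall] at hG ⊢
    intro x hx
    refine (LinearMap.map_eq_zero_iff i hi).1 (hG _ fun γ hγ => ?_)
    rw [← map_smul, hx γ hγ]

end Main
end CLM

end

theorem mainTheorem2 :
    -- the moments of `X(A, u, O)` and of its components
    (∀ (A : Type*) [Ring A] [Algebra ℚ A] [Module.Finite ℚ A] [IsSemisimpleRing A]
      (S : Set Nat.Primes) (O : Subalgebra (CLM.ZS S) A) (hO : CLM.IsMaximalOrder O)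
      (u : CLM.IrrIdem A → ℚ)
      (Ω : Type*) (P : PMF Ω) (X : Ω → Type*)
      [∀ ω, AddCommGroup (X ω)] [∀ ω, Module O (X ω)],
      CLM.IsCLMRandomModule hO u P X →
      ∀ (H : Type*) [AddCommGroup H] [Module O H] [Finite H],
        CLM.expect P (fun ω => CLM.numSur O (X ω) H) = (CLM.cardPow hO u H)⁻¹ ∧
        ∀ (e : O) (_ : e * e = e) (hc : ∀ r : O, e * r = r * e),
          (CLM.component e hc H = ⊤ →
            CLM.expect P (fun ω => CLM.numSur O (CLM.component e hc (X ω)) H) =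
              (CLM.cardPow hO u H)⁻¹) ∧
          (CLM.component e hc H ≠ ⊤ →
            CLM.expect P (fun ω => CLM.numSur O (CLM.component e hc (X ω)) H) = 0)) ∧
    -- the moments of the distribution attached to `Γ`-fields
    (∀ (Γ : Type*) [Group Γ] [Finite Γ] (Γinf : Subgroup Γ)
      (Ω : Type*) (P : PMF Ω) (X : Ω → Type*)
      [∀ ω, AddCommGroup (X ω)] [∀ ω, Module (CLM.AwayGroupRing Γ) (X ω)],
      CLM.IsCLMForGaloisFields Γinf P X →
      ∀ (H : Type*) [AddCommGroup H] [Module (CLM.AwayGroupRing Γ) H] [Finite H],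
        CLM.invariants (⊤ : Subgroup Γ) H = ⊥ →
        CLM.expect P (fun ω => CLM.numSur (CLM.AwayGroupRing Γ) (X ω) H) =
          (Nat.card (CLM.invariants Γinf H) : ENNReal)⁻¹) := by
  refine ⟨?_, ?_⟩
  · intro A _ _ _ _ S O hO u Ω P X _ _ hX H _ _ _
    have hmom := CLM.expect_numSur_of_isCLMRandomModule hO u P X hX H
    refine ⟨hmom, fun e he hc => ⟨fun htop => ?_, fun hne => ?_⟩⟩
    · simp only [CLM.numSur_component he hc htop, hmom]
    · simp only [CLM.expect, CLM.numSur_component_eq_zero he hc hne, mul_zero, tsum_zero]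
  · intro Γ _ _ Γinf Ω P X _ _ hX H _ _ _ hH
    exact CLM.expect_numSur_of_isCLMForGaloisFields Γinf P X hX H hH
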